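/- Let $d\ge 1$, let $\Omega\subset\mathbb R^d$ be a bounded open set (in particular, a bounded Lipschitz domain), $T>0$, $\alpha\in(0,1)$. Let $a=(a_{ij})$ and $b=(b_i)$ have entries in $L_\infty(\Omega\times(0,T))$, let $a(x,t)$ be symmetric positive definite with minimal eigenvalue $\lambda_a(x,t)>0$, and assume $$C_{\mathcal L}:=\sup_{\Omega\times(0,T)}\frac{\sum_{i=1}^d b_i^2}{4\lambda_a}<\infty .$$ Let $c$ be measurable with $\inf_{\Omega\times(0,T)}c\ge-\lambda$ for some constant $\lambda\ge 0$. (Suprema, infima and inequalities for elements of Lebesgue spaces are understood almost everywhere.) Let $$\mathcal L w=-\sum_{i,j=1}^d\partial_{x_i}\bigl(a_{ij}\,\partial_{x_j}w\bigr)+\sum_{i=1}^d b_i\,\partial_{x_i}w,\qquad D_t^\alpha u(t)=\frac1{\Gamma(1-\alpha)}\int_0^t(t-s)^{-\alpha}\,\partial_s u(s)\,ds,$$ where the integral is an $L_\infty(\Omega)$-valued Bochner integral, improper at $s=0$ (the limit of $\int_\epsilon^t$ as $\epsilon\to0^+$). Suppose that $u\in C([0,T];L_\infty(\Omega))\cap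 W^{1,\infty}(\epsilon,t;L_\infty(\Omega))$ for all $0<\epsilon<t\le T$, that $u(\cdot,t)\in H^1(\Omega)$ for all $t\in(0,T]$, that $u(\cdot,0)\le0$ in $\Omega$, and that $u(\cdot,t)\le 0$ on $\partial\Omega$ for all $t\in[0,T]$ in the sense that $u(\cdot,t)^+=\max\{0,u(\cdot,t)\}\in H^1_0(\Omega)$. Suppose that $(D_t^\alpha+\mathcal L+c)u\le0$ in the weak sense, that is, for almost every $t\in(0,T)$ (in particular, if this holds for every $t\in(0,T]$) and every nonnegative $\chi\in H_0^1(\Omega)$ the function $c\,u\,\chi$ is integrable over $\Omega$ (which is automatic if $c\in L_\infty$) and $$\int_\Omega (D_t^\alpha u)\,\chi\,dx+\int_\Omega\sum_{i,j}a_{ij}\,\partial_{x_j}u\,\partial_{x_i}\chi\,dx+\int_\Omega\sum_i b_i\,\partial_{x_i}u\,\chi\,dx+\int_\Omega c\,u\,\chi\,dx\le0 .$$ Then $\sup_\Omega u(\cdot,t)\le0$ for all $t\in[0,T]$. -/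

import Mathlib

open MeasureTheory Filter Topology Set
open scoped ENNReal ContDiff

namespace FracMaxPrinciple

/-! ### Functions of time with values in a Banach space -/

section Time

variable {X : Type*} [NormedAddCommGroup X] [NormedSpace ℝ X]

/-- `g` is the weak derivative of `u` on the time interval `(a, b)`: both are locally
(Bochner) integrable there and `∫ φ' u = - ∫ φ g` for all `φ ∈ C_c^∞(a, b)`. -/
def IsWeakTimeDeriv (a b : ℝ) (u g : ℝ → X) : Prop :=
  LocallyIntegrableOn u (Ioo a b) ∧ LocallyIntegrableOn g (Ioo a b) ∧
    ∀ φ : ℝ → ℝ, ContDiff ℝ ∞ φ → HasCompactSupport φ → tsupport φ ⊆ Ioo a b →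
      ∫ s in Ioo a b, deriv φ s • u s = - ∫ s in Ioo a b, φ s • g s

/-- The Bochner–Sobolev space `W^{1,∞}(a, b; X)`. -/
def MemW1Infty (a b : ℝ) (u : ℝ → X) : Prop :=
  MemLp u ∞ (volume.restrict (Ioo a b)) ∧
    ∃ g : ℝ → X, MemLp g ∞ (volume.restrict (Ioo a b)) ∧ IsWeakTimeDeriv a b u g

/-- `D` is the Caputo derivative of order `α` of `u` at the time `t > 0`:
`D = Γ(1 - α)⁻¹ ∫₀ᵗ (t - s)^(-α) u'(s) ds`, where `u'` is the weak derivative of `u` on `(0, t)`.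
As `u'` need not be integrable near `s = 0`, the integral is improper at its lower end; when `u'` is
integrable there, this is the usual Bochner integral over `(0, t)`. -/
def HasCaputoDeriv (α : ℝ) (u : ℝ → X) (t : ℝ) (D : X) : Prop :=
  ∃ g : ℝ → X, IsWeakTimeDeriv 0 t u g ∧
    (∀ ε ∈ Ioo 0 t, IntegrableOn (fun s => (t - s) ^ (-α) • g s) (Ioo ε t)) ∧
    Tendsto (fun ε => (Real.Gamma (1 - α))⁻¹ • ∫ s in Ioo ε t, (t - s) ^ (-α) • g s)
      (𝓝[>] 0) (𝓝 D)

end Time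

/-! ### Sobolev spaces on `Ω ⊆ ℝᵈ` -/

section Space

variable {d : ℕ}

/-- `C_c^∞(Ω)`. -/
def IsTestFun (Ω : Set (EuclideanSpace ℝ (Fin d))) (φ : EuclideanSpace ℝ (Fin d) → ℝ) : Prop :=
  ContDiff ℝ ∞ φ ∧ HasCompactSupport φ ∧ tsupport φ ⊆ Ω

/-- The classical partial derivative `∂φ/∂x_i`. -/
noncomputable def pderiv (i : Fin d) (φ : EuclideanSpace ℝ (Fin d) → ℝ)
    (x : EuclideanSpace ℝ (Fin d)) : ℝ :=
  fderiv ℝ φ x (EuclideanSpace.single i 1)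

/-- `w ∈ H¹(Ω)` with weak gradient `G` (determined up to a null set): `w, G ∈ L²(Ω)` and
`∫_Ω w ∂ᵢφ = - ∫_Ω Gᵢ φ` for all `φ ∈ C_c^∞(Ω)` and all `i`. -/
def IsH1Grad (Ω : Set (EuclideanSpace ℝ (Fin d))) (w : EuclideanSpace ℝ (Fin d) → ℝ)
    (G : EuclideanSpace ℝ (Fin d) → EuclideanSpace ℝ (Fin d)) : Prop :=
  MemLp w 2 (volume.restrict Ω) ∧ MemLp G 2 (volume.restrict Ω) ∧
    ∀ φ : EuclideanSpace ℝ (Fin d) → ℝ, IsTestFun Ω φ → ∀ i : Fin d,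
      ∫ x in Ω, w x * pderiv i φ x = - ∫ x in Ω, G x i * φ x

/-- `H¹(Ω)`. -/
def MemH1 (Ω : Set (EuclideanSpace ℝ (Fin d))) (w : EuclideanSpace ℝ (Fin d) → ℝ) : Prop :=
  ∃ G, IsH1Grad Ω w G

/-- `H¹₀(Ω)`, the closure of `C_c^∞(Ω)` in `H¹(Ω)`. -/
def MemH10 (Ω : Set (EuclideanSpace ℝ (Fin d))) (w : EuclideanSpace ℝ (Fin d) → ℝ) : Prop :=
  ∃ G, IsH1Grad Ω w G ∧ ∃ φ : ℕ → EuclideanSpace ℝ (Fin d) → ℝ,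
    (∀ n, IsTestFun Ω (φ n)) ∧
    Tendsto (fun n => eLpNorm (fun x => w x - φ n x) 2 (volume.restrict Ω)) atTop (𝓝 0) ∧
    ∀ i : Fin d,
      Tendsto (fun n => eLpNorm (fun x => G x i - pderiv i (φ n) x) 2 (volume.restrict Ω))
        atTop (𝓝 0)

/-- `L^∞(Ω)`, with its essential supremum norm. -/
abbrev LInfty (Ω : Set (EuclideanSpace ℝ (Fin d))) : Type :=
  Lp ℝ ∞ (volume.restrict Ω)

/-- The minimal eigenvalue of a (symmetric) real matrix. -/
noncomputable def minEigenvalue (A : Matrix (Fin d) (Fin d) ℝ) : ℝ :=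
  sInf (spectrum ℝ A)

/-- `(D_t^α + 𝓛 + c) u ≤ 0` at the time `t` in the weak sense, where
`𝓛 w = - ∑ ∂ᵢ(a_ij ∂ⱼ w) + ∑ bᵢ ∂ᵢ w` with the coefficients `a`, `b`, `c` at the time `t`:
`⟨D_t^α u, χ⟩ + ⟨𝓛 u, χ⟩ + ⟨c u, χ⟩ ≤ 0` for all nonnegative `χ ∈ H¹₀(Ω)`. Here `⟨𝓛 u, χ⟩` is the
bilinear form of `𝓛`, `G` is the gradient of `u(t)` and `H` that of `χ`. For an unbounded `c` the
existence of the integral `⟨c u, χ⟩` is part of the meaning; for a bounded one it is automatic. -/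
def WeakSubAt (Ω : Set (EuclideanSpace ℝ (Fin d))) (α : ℝ)
    (a : EuclideanSpace ℝ (Fin d) → Matrix (Fin d) (Fin d) ℝ)
    (b : EuclideanSpace ℝ (Fin d) → Fin d → ℝ) (c : EuclideanSpace ℝ (Fin d) → ℝ)
    (u : ℝ → LInfty Ω) (t : ℝ) : Prop :=
  ∃ D : LInfty Ω, HasCaputoDeriv α u t D ∧ ∃ G, IsH1Grad Ω (u t) G ∧
    ∀ χ H, MemH10 Ω χ → IsH1Grad Ω χ H → (∀ᵐ x ∂(volume.restrict Ω), 0 ≤ χ x) →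
      IntegrableOn (fun x => c x * u t x * χ x) Ω ∧
      (∫ x in Ω, D x * χ x)
        + ((∫ x in Ω, ∑ i, ∑ j, a x i j * G x j * H x i)
          + ∫ x in Ω, ∑ i, b x i * G x i * χ x)
        + (∫ x in Ω, c x * u t x * χ x) ≤ 0

end Space

end FracMaxPrinciple

namespace FracMaxPrinciple

/-! ### Weak time derivatives of continuous functions. -/

section Time

variable {X : Type*} [NormedAddCommGroup X] [NormedSpace ℝ X]

/-! The inequality is tested with `u(t)⁺`, which the boundary condition makes admissible. This gives
a scalar fractional inequality for `w(t)`, the `L²(Ω)` norm of `u(t)⁺`, and that inequality forces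
`w = 0`.

In space, the gradient of `u⁺` is that of `u` where `u ≥ 0` and vanishes where `u ≤ 0`
(`ae_grad_posPart`). Completing the square then absorbs the drift into the diffusion at the cost of
`C (u⁺)²`, so the elliptic and reaction terms are at least `-(C + lam) w²`
(`neg_mul_integral_sq_le_form`). The vanishing of weak gradients on zero sets comes from a
translation argument (`ae_eq_zero_of_eq_zero_of_integral`).

In time, writing `(t - s)^(-α)` as the integral of `α r^(-α-1)` over `r > t - s` and applying Fubini
turns the Caputo integral into a positively weighted integral of differences `u(t) - u(t - r)`
(`IsWeakTimeDeriv.caputo_eq_marchaud`). Paired with `u(t)⁺`, such a difference is at least `w(t)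
(w(t) - w(t - r))` (`norm_mul_sub_le_pairing`). Since `u(0)⁺ = 0`, extending `w` by zero to negative
times is continuous and accounts for the history `r > t`. Hence `w · marchaud w ≤ K w²` for almost
every time, with `K = Γ(1 - α)(C + lam)` (`HasCaputoDeriv.mul_marchaud_le`).

Finally, at a positive maximum of `w(t) exp(-t/δ)` the past of `w` decays exponentially, so
`marchaud w` is at least a multiple of `w` that exceeds `K` once `δ` is small. This is a
contradiction (`eq_zero_of_mul_marchaud_le`). -/

lemma deriv_smoothTransition_eq_zero {x : ℝ} (hx : x ∉ Icc (0 : ℝ) 1) :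
    deriv Real.smoothTransition x = 0 := by
  rw [mem_Icc, not_and_or, not_le, not_le] at hx
  rcases hx with hx | hx
  · have : Real.smoothTransition =ᶠ[𝓝 x] fun _ => 0 := by
      filter_upwards [Iio_mem_nhds hx] with y hy
      exact Real.smoothTransition.zero_of_nonpos (le_of_lt hy)
    rw [this.deriv_eq, deriv_const]
  · have : Real.smoothTransition =ᶠ[𝓝 x] fun _ => 1 := by
      filter_upwards [Ioi_mem_nhds hx] with y hy
      exact Real.smoothTransition.one_of_one_le (le_of_lt hy)
    rw [this.deriv_eq, deriv_const]

lemma continuous_deriv_smoothTransition : Continuous (deriv Real.smoothTransition) :=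
  (Real.smoothTransition.contDiff (n := 1)).continuous_deriv le_rfl

lemma integral_deriv_smoothTransition : ∫ y in (0 : ℝ)..1, deriv Real.smoothTransition y = 1 := by
  rw [intervalIntegral.integral_deriv_eq_sub]
  · simp
  · exact fun x _ => (Real.smoothTransition.contDiff (n := 1)).differentiable one_ne_zero x
  · exact continuous_deriv_smoothTransition.intervalIntegrable _ _

/-- The average of `v` over `[c, c + δ]` with respect to the smooth weight `S'`, where `S` is the
smooth transition function. -/
noncomputable def smoothAverage (v : ℝ → X) (c δ : ℝ) : X :=
  ∫ y in (0 : ℝ)..1, deriv Real.smoothTransition y • v (c + δ * y)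

lemma continuous_smoothAverage {v : ℝ → X} (hv : Continuous v) :
    Continuous fun p : ℝ × ℝ => smoothAverage v p.1 p.2 := by
  unfold smoothAverage
  refine intervalIntegral.continuous_parametric_intervalIntegral_of_continuous' ?_ 0 1
  have := continuous_deriv_smoothTransition
  fun_prop

lemma smoothAverage_zero [CompleteSpace X] (v : ℝ → X) (c : ℝ) : smoothAverage v c 0 = v c := by
  simp [smoothAverage, intervalIntegral.integral_smul_const, integral_deriv_smoothTransition]

/-- The substitution `x = c + δ y` produces exactly the bumps that make up the derivative of
`smoothIndicator`. -/
lemma smoothAverage_eq (v : ℝ → X) (c : ℝ) {δ : ℝ} (hδ : 0 < δ) :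
    smoothAverage v c δ =
      ∫ x in Icc c (c + δ), (δ⁻¹ * deriv Real.smoothTransition ((x - c) / δ)) • v x := by
  have h := intervalIntegral.smul_integral_comp_add_mul (a := 0) (b := 1)
    (fun x => (δ⁻¹ * deriv Real.smoothTransition ((x - c) / δ)) • v x) δ c
  rw [integral_Icc_eq_integral_Ioc, ← intervalIntegral.integral_of_le (by linarith)]
  rw [mul_zero, add_zero, mul_one] at h
  rw [← h, ← intervalIntegral.integral_smul, smoothAverage]
  refine intervalIntegral.integral_congr fun y _ => ?_
  have h1 : (c + δ * y - c) / δ = y := by field_simp; ring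
  simp only [h1, smul_smul]
  rw [← mul_assoc, mul_inv_cancel₀ hδ.ne', one_mul]

/-- A smooth approximation of the indicator function of `[s, t]`. -/
noncomputable def smoothIndicator (s t δ x : ℝ) : ℝ :=
  Real.smoothTransition ((x - s) / δ) - Real.smoothTransition ((x - (t - δ)) / δ)

lemma contDiff_smoothIndicator (s t δ : ℝ) : ContDiff ℝ ∞ (smoothIndicator s t δ) := by
  unfold smoothIndicator
  have h := Real.smoothTransition.contDiff (n := ⊤)
  exact (h.comp (by fun_prop)).sub (h.comp (by fun_prop))

lemma smoothIndicator_eq_zero {s t δ x : ℝ} (hδ : 0 < δ) (hst : s + δ ≤ t) (hx : x ∉ Icc s t) :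
    smoothIndicator s t δ x = 0 := by
  rw [mem_Icc, not_and_or, not_le, not_le] at hx
  unfold smoothIndicator
  rcases hx with hx | hx
  · rw [Real.smoothTransition.zero_of_nonpos (div_nonpos_of_nonpos_of_nonneg (by linarith) hδ.le),
      Real.smoothTransition.zero_of_nonpos (div_nonpos_of_nonpos_of_nonneg (by linarith) hδ.le),
      sub_zero]
  · rw [Real.smoothTransition.one_of_one_le ((one_le_div hδ).2 (by linarith)),
      Real.smoothTransition.one_of_one_le ((one_le_div hδ).2 (by linarith)), sub_self]

lemma tsupport_smoothIndicator_subset {s t δ : ℝ} (hδ : 0 < δ) (hst : s + δ ≤ t) :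
    tsupport (smoothIndicator s t δ) ⊆ Icc s t :=
  closure_minimal (fun _ hx => by_contra fun h => hx (smoothIndicator_eq_zero hδ hst h))
    isClosed_Icc

lemma abs_smoothIndicator_le (s t δ x : ℝ) : |smoothIndicator s t δ x| ≤ 1 := by
  unfold smoothIndicator
  rw [abs_le]
  constructor <;> linarith [Real.smoothTransition.nonneg ((x - s) / δ),
    Real.smoothTransition.nonneg ((x - (t - δ)) / δ), Real.smoothTransition.le_one ((x - s) / δ),
    Real.smoothTransition.le_one ((x - (t - δ)) / δ)]

lemma tendsto_smoothIndicator {s t x : ℝ} (hx : x ∈ Ioo s t) :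
    Tendsto (fun δ => smoothIndicator s t δ x) (𝓝[>] 0) (𝓝 1) := by
  refine tendsto_const_nhds.congr' ?_
  have h1 : ∀ᶠ δ in 𝓝[>] (0 : ℝ), δ < x - s :=
    nhdsWithin_le_nhds (Iio_mem_nhds (sub_pos.2 hx.1))
  have h2 : ∀ᶠ δ in 𝓝[>] (0 : ℝ), δ < t - x :=
    nhdsWithin_le_nhds (Iio_mem_nhds (sub_pos.2 hx.2))
  filter_upwards [h1, h2, self_mem_nhdsWithin] with δ h1 h2 hδ
  have hδ : 0 < δ := hδ
  unfold smoothIndicator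
  rw [Real.smoothTransition.one_of_one_le ((one_le_div hδ).2 h1.le),
    Real.smoothTransition.zero_of_nonpos (div_nonpos_of_nonpos_of_nonneg (by linarith) hδ.le),
    sub_zero]

lemma deriv_smoothIndicator (s t δ x : ℝ) :
    deriv (smoothIndicator s t δ) x = δ⁻¹ * deriv Real.smoothTransition ((x - s) / δ)
      - δ⁻¹ * deriv Real.smoothTransition ((x - (t - δ)) / δ) := by
  have h : ∀ c, HasDerivAt (fun x => Real.smoothTransition ((x - c) / δ))
      (δ⁻¹ * deriv Real.smoothTransition ((x - c) / δ)) x := by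
    intro c
    have h1 : HasDerivAt (fun x : ℝ => (x - c) / δ) (1 / δ) x :=
      ((hasDerivAt_id x).sub_const c).div_const δ
    have h2 := ((Real.smoothTransition.contDiff (n := 1)).differentiable one_ne_zero
      ((x - c) / δ)).hasDerivAt
    simpa [mul_comm, one_div] using! h2.comp x h1
  exact ((h s).sub (h (t - δ))).deriv

/-- The derivative of the cutoff is a unit-mass bump on `[s, s + δ]` minus one on `[t - δ, t]`; both
intervals lie in `[s, t]`. -/
lemma setIntegral_deriv_smoothIndicator_smul {v : ℝ → X} (hv : Continuous v) {s t δ : ℝ}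
    (hδ : 0 < δ) (hst : s + δ ≤ t) :
    ∫ x in Icc s t, deriv (smoothIndicator s t δ) x • v x
      = smoothAverage v s δ - smoothAverage v (t - δ) δ := by
  have hS := continuous_deriv_smoothTransition
  have hi : ∀ c, IntegrableOn
      (fun x => (δ⁻¹ * deriv Real.smoothTransition ((x - c) / δ)) • v x) (Icc s t) := fun c =>
    (by fun_prop : Continuous _).continuousOn.integrableOn_compact isCompact_Icc
  have key : ∀ c, s ≤ c → c + δ ≤ t → smoothAverage v c δ =
      ∫ x in Icc s t, (δ⁻¹ * deriv Real.smoothTransition ((x - c) / δ)) • v x := by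
    intro c hc hc'
    rw [smoothAverage_eq v c hδ]
    symm
    refine setIntegral_eq_of_subset_of_forall_sdiff_eq_zero measurableSet_Icc
      (Icc_subset_Icc hc hc') fun x hx => ?_
    rw [deriv_smoothTransition_eq_zero, mul_zero, zero_smul]
    rintro ⟨h0, h1⟩
    refine hx.2 ⟨?_, ?_⟩
    · have := (le_div_iff₀ hδ).1 h0
      linarith
    · have := (div_le_one hδ).1 h1
      linarith
  rw [key s le_rfl hst, key (t - δ) (by linarith) (by linarith), ← integral_sub (hi _) (hi _)]
  simp_rw [deriv_smoothIndicator, sub_smul]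

/-- A continuous function is the integral of its weak derivative. -/
theorem IsWeakTimeDeriv.sub_eq_integral [CompleteSpace X] {a b : ℝ} {u g : ℝ → X}
    (h : IsWeakTimeDeriv a b u g) (hu : ContinuousOn u (Ioo a b)) {s t : ℝ} (hs : a < s)
    (hst : s < t) (ht : t < b) : u t - u s = ∫ x in Icc s t, g x := by
  obtain ⟨-, hg, hφ⟩ := h
  have hsub : Icc s t ⊆ Ioo a b := Icc_subset_Ioo hs ht
  have hgi : IntegrableOn g (Icc s t) := hg.integrableOn_compact_subset hsub isCompact_Icc
  -- Clamping to `[s, t]` gives a globally continuous function, so the averages are jointly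
  -- continuous in `c` and `δ`, down to `δ = 0`.
  set v : ℝ → X := fun x => u (projIcc s t hst.le x) with hv
  have hvc : Continuous v :=
    (continuousOn_iff_continuous_domRestrict.1 (hu.mono hsub)).comp continuous_projIcc
  have hvu : ∀ x ∈ Icc s t, v x = u x := fun x hx => by simp [hv, projIcc_of_mem hst.le hx]
  have hδ' : ∀ᶠ δ in 𝓝[>] (0 : ℝ), 0 < δ ∧ s + δ ≤ t := by
    have h1 : ∀ᶠ δ in 𝓝[>] (0 : ℝ), δ < t - s :=
      nhdsWithin_le_nhds (Iio_mem_nhds (sub_pos.2 hst))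
    filter_upwards [h1, self_mem_nhdsWithin] with δ h1 h2
    exact ⟨h2, by linarith⟩
  have hlim1 : Tendsto (fun δ => smoothAverage v s δ - smoothAverage v (t - δ) δ) (𝓝[>] 0)
      (𝓝 (u s - u t)) := by
    have hc := continuous_smoothAverage hvc
    have h1 : Continuous fun δ => smoothAverage v s δ - smoothAverage v (t - δ) δ :=
      (hc.comp (by fun_prop : Continuous fun δ : ℝ => (s, δ))).sub
        (hc.comp (by fun_prop : Continuous fun δ : ℝ => (t - δ, δ)))
    have h2 := (h1.tendsto 0).mono_left (nhdsWithin_le_nhds (s := Ioi 0))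
    rwa [sub_zero, smoothAverage_zero, smoothAverage_zero, hvu s (left_mem_Icc.2 hst.le),
      hvu t (right_mem_Icc.2 hst.le)] at h2
  have hlim2 : Tendsto (fun δ => ∫ x in Icc s t, smoothIndicator s t δ x • g x) (𝓝[>] 0)
      (𝓝 (∫ x in Icc s t, g x)) := by
    refine tendsto_integral_filter_of_dominated_convergence (fun x => ‖g x‖) ?_ ?_ hgi.norm ?_
    · filter_upwards with δ
      exact (contDiff_smoothIndicator s t δ).continuous.aestronglyMeasurable.smul
        hgi.aestronglyMeasurable
    · filter_upwards with δ
      filter_upwards with x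
      rw [norm_smul, Real.norm_eq_abs]
      exact mul_le_of_le_one_left (norm_nonneg _) (abs_smoothIndicator_le s t δ x)
    · rw [Measure.restrict_congr_set Ioo_ae_eq_Icc.symm]
      filter_upwards [ae_restrict_mem measurableSet_Ioo] with x hx
      simpa using (tendsto_smoothIndicator hx).smul_const (g x)
  -- For small `δ` the cutoff is an admissible test function; letting `δ → 0` in the resulting
  -- identity gives the claim.
  have heq : ∀ᶠ δ in 𝓝[>] (0 : ℝ), smoothAverage v s δ - smoothAverage v (t - δ) δ
      = - ∫ x in Icc s t, smoothIndicator s t δ x • g x := by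
    filter_upwards [hδ'] with δ ⟨hδ, hδt⟩
    have hts := tsupport_smoothIndicator_subset hδ hδt
    have h1 := hφ (smoothIndicator s t δ) (contDiff_smoothIndicator s t δ)
      (isCompact_Icc.of_isClosed_subset (isClosed_tsupport _) hts) (hts.trans hsub)
    have h2 : ∫ x in Ioo a b, deriv (smoothIndicator s t δ) x • u x
        = ∫ x in Icc s t, deriv (smoothIndicator s t δ) x • u x := by
      refine setIntegral_eq_of_subset_of_forall_sdiff_eq_zero measurableSet_Ioo hsub
        fun x hx => ?_
      have : deriv (smoothIndicator s t δ) x = 0 := by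
        by_contra hne
        exact hx.2 (hts (support_deriv_subset hne))
      rw [this, zero_smul]
    have h3 : ∫ x in Ioo a b, smoothIndicator s t δ x • g x
        = ∫ x in Icc s t, smoothIndicator s t δ x • g x :=
      setIntegral_eq_of_subset_of_forall_sdiff_eq_zero measurableSet_Ioo hsub
        fun x hx => by rw [smoothIndicator_eq_zero hδ hδt hx.2, zero_smul]
    rw [← h3, ← h1, h2, ← setIntegral_deriv_smoothIndicator_smul hvc hδ hδt]
    refine setIntegral_congr_fun measurableSet_Icc fun x hx => ?_
    simp only [hvu x hx]
  have := tendsto_nhds_unique (hlim1.congr' heq) hlim2.neg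
  rw [← neg_sub, this, neg_neg]

/-- The essential bound of the weak derivative is a Lipschitz constant on the open interval;
continuity carries it to the endpoints. -/
lemma MemW1Infty.exists_lipschitzOnWith [CompleteSpace X] {a b : ℝ} {u : ℝ → X} (hab : a < b)
    (h : MemW1Infty a b u) (hu : ContinuousOn u (Icc a b)) :
    ∃ L, LipschitzOnWith L u (Icc a b) := by
  obtain ⟨-, g, hg, hug⟩ := h
  obtain ⟨L, hL0, hL⟩ : ∃ L : ℝ, 0 ≤ L ∧ ∀ᵐ s ∂volume.restrict (Ioo a b), ‖g s‖ ≤ L :=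
    ⟨(eLpNorm g ∞ (volume.restrict (Ioo a b))).toReal, ENNReal.toReal_nonneg, by
      filter_upwards [ae_le_eLpNormEssSup (f := g) (μ := volume.restrict (Ioo a b))] with s hs
      rw [← eLpNorm_exponent_top] at hs
      simpa using ENNReal.toReal_mono hg.eLpNorm_ne_top hs⟩
  refine ⟨⟨L, hL0⟩, ?_⟩
  have key : ∀ s t, a < s → s < t → t < b → ‖u t - u s‖ ≤ L * (t - s) := by
    intro s t hs hst ht
    rw [hug.sub_eq_integral (hu.mono Ioo_subset_Icc_self) hs hst ht]
    have := norm_setIntegral_le_of_norm_le_const_ae (μ := volume) (s := Icc s t) (f := g) (C := L)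
      (by simp) (ae_restrict_of_ae_restrict_of_subset (Icc_subset_Ioo hs ht) hL)
    simpa [Measure.real, ENNReal.toReal_ofReal (sub_nonneg.2 hst.le)] using this
  have hIoo : LipschitzOnWith ⟨L, hL0⟩ u (Ioo a b) := by
    refine LipschitzOnWith.of_dist_le_mul fun s hs t ht => ?_
    rcases lt_trichotomy s t with hst | rfl | hst
    · rw [dist_comm, dist_eq_norm, dist_comm s t, Real.dist_eq, abs_of_pos (sub_pos.2 hst)]
      exact key s t hs.1 hst ht.2
    · simp
    · rw [dist_eq_norm, Real.dist_eq, abs_of_pos (sub_pos.2 hst)]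
      exact key t s ht.1 hst hs.2
  have := hIoo.closure (by rwa [closure_Ioo hab.ne])
  rwa [closure_Ioo hab.ne] at this

/-! ### The kernel `α r^(-α-1)` and the Marchaud form of the Caputo integral. -/

lemma integrableOn_mul_rpow_Ioi {α : ℝ} (hα : 0 < α) {c : ℝ} (hc : 0 < c) :
    IntegrableOn (fun r : ℝ => α * r ^ (-α - 1)) (Ioi c) :=
  (integrableOn_Ioi_rpow_of_lt (by linarith) hc).const_mul α

lemma integral_mul_rpow_Ioi {α : ℝ} (hα : 0 < α) {c : ℝ} (hc : 0 < c) :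
    ∫ r in Ioi c, α * r ^ (-α - 1) = c ^ (-α) := by
  rw [integral_const_mul, integral_Ioi_rpow_of_lt (by linarith) hc]
  have : -α - 1 + 1 = -α := by ring
  rw [this]
  field_simp

/-- The inverse weight `(t - s)^α` is bounded on `(ε, t)`, so the weight can be divided out. -/
lemma integrableOn_of_integrableOn_rpow_smul {α : ℝ} (hα : 0 < α) {ε t : ℝ} {g : ℝ → X}
    (hi : IntegrableOn (fun s => (t - s) ^ (-α) • g s) (Ioo ε t)) :
    IntegrableOn g (Ioo ε t) := by
  have h : IntegrableOn (fun s => (t - s) ^ α • (t - s) ^ (-α) • g s) (Ioo ε t) := by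
    refine Integrable.bdd_smul hi ((t - ε) ^ α) ?_ ?_
    · exact (by fun_prop : Measurable fun s : ℝ => (t - s) ^ α).aestronglyMeasurable
    · filter_upwards [ae_restrict_mem measurableSet_Ioo] with s hs
      rw [Real.norm_eq_abs, abs_of_nonneg (Real.rpow_nonneg (by linarith [hs.2]) _)]
      exact Real.rpow_le_rpow (by linarith [hs.2]) (by linarith [hs.1]) hα.le
  refine h.congr_fun (fun s hs => ?_) measurableSet_Ioo
  have h0 : 0 < t - s := sub_pos.2 hs.2
  simp only [smul_smul]
  rw [← Real.rpow_add h0, add_neg_cancel, Real.rpow_zero, one_smul]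

/-- The weak derivative lives on the open interval `(0, t)`, so the endpoint `t` is reached as a
limit of `r < t`, by continuity of `u` and of the primitive of `g`. -/
lemma IsWeakTimeDeriv.sub_eq_setIntegral_Ioo [CompleteSpace X] {t : ℝ} {u g : ℝ → X}
    (h : IsWeakTimeDeriv 0 t u g) (hu : ContinuousOn u (Icc 0 t)) {s : ℝ} (hs : 0 < s)
    (hst : s < t) (hg : IntegrableOn g (Ioo s t)) : u t - u s = ∫ x in Ioo s t, g x := by
  have hgi : IntegrableOn g (Icc s t) := by rwa [integrableOn_Icc_iff_integrableOn_Ioo]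
  have h1 : ContinuousOn (fun r => ∫ x in s..r, g x) (Icc s t) := by
    rw [← uIcc_of_le hst.le] at hgi ⊢
    exact intervalIntegral.continuousOn_primitive_interval hgi
  have h2 : Tendsto (fun r => ∫ x in s..r, g x) (𝓝[<] t) (𝓝 (∫ x in s..t, g x)) :=
    ((h1 t (right_mem_Icc.2 hst.le)).mono Ioo_subset_Icc_self).mono_left
      (nhdsWithin_Ioo_eq_nhdsLT hst).ge
  have h3 : Tendsto (fun r => u r - u s) (𝓝[<] t) (𝓝 (u t - u s)) :=
    ((((hu t (right_mem_Icc.2 (hs.trans hst).le)).mono (fun x hx => ⟨(hs.trans hx.1).le,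
      hx.2.le⟩ : Ioo s t ⊆ Icc 0 t)).mono_left (nhdsWithin_Ioo_eq_nhdsLT hst).ge)).sub_const _
  rw [← integral_Ioc_eq_integral_Ioo, ← intervalIntegral.integral_of_le hst.le]
  refine tendsto_nhds_unique (h3.congr' ?_) h2
  filter_upwards [Ioo_mem_nhdsLT hst] with r hr
  rw [h.sub_eq_integral (hu.mono Ioo_subset_Icc_self) hs hr.1 hr.2,
    integral_Icc_eq_integral_Ioc, ← intervalIntegral.integral_of_le hr.1.le]

/-- The truncated Caputo integral in Marchaud form. -/
theorem IsWeakTimeDeriv.caputo_eq_marchaud [CompleteSpace X] {α : ℝ} (hα : 0 < α) {t : ℝ}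
    {u g : ℝ → X} (h : IsWeakTimeDeriv 0 t u g) (hu : ContinuousOn u (Icc 0 t)) {ε : ℝ}
    (hε : ε ∈ Ioo 0 t) (hi : IntegrableOn (fun s => (t - s) ^ (-α) • g s) (Ioo ε t)) :
    IntegrableOn (fun r => (α * r ^ (-α - 1)) • (u t - u (max (t - r) ε))) (Ioi 0) ∧
    ∫ s in Ioo ε t, (t - s) ^ (-α) • g s
      = ∫ r in Ioi 0, (α * r ^ (-α - 1)) • (u t - u (max (t - r) ε)) := by
  have hg := integrableOn_of_integrableOn_rpow_smul hα hi
  -- Fubini on the region `r > t - s`: integrating the kernel in `r` first gives `(t - s)^(-α)`,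
  -- integrating `g` in `s` first gives a difference of `u`.
  set A : Set (ℝ × ℝ) := {p | t - p.2 < p.1} with hA
  have hAm : MeasurableSet A := measurableSet_lt (by fun_prop) (by fun_prop)
  set Φ : ℝ × ℝ → X := A.indicator fun p => (α * p.1 ^ (-α - 1)) • g p.2 with hΦ
  have hΦm : AEStronglyMeasurable Φ
      ((volume.restrict (Ioi 0)).prod (volume.restrict (Ioo ε t))) := by
    refine AEStronglyMeasurable.indicator ?_ hAm
    exact AEStronglyMeasurable.smul
      (by fun_prop : Measurable fun p : ℝ × ℝ => α * p.1 ^ (-α - 1)).aestronglyMeasurable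
      hg.aestronglyMeasurable.comp_snd
  have hfib : ∀ s, (fun r => Φ (r, s)) =
      (Ioi (t - s)).indicator fun r => (α * r ^ (-α - 1)) • g s := by
    intro s; ext r; simp [hΦ, hA, indicator]
  have hfibint : ∀ s ∈ Ioo ε t, ∀ F : ℝ → X,
      ∫ r in Ioi 0, (Ioi (t - s)).indicator F r = ∫ r in Ioi (t - s), F r := by
    intro s hs F
    rw [setIntegral_indicator measurableSet_Ioi,
      inter_eq_right.2 (Ioi_subset_Ioi (sub_nonneg.2 hs.2.le))]
  have hΦi : Integrable Φ ((volume.restrict (Ioi 0)).prod (volume.restrict (Ioo ε t))) := by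
    rw [integrable_prod_iff' hΦm]
    constructor
    · filter_upwards [ae_restrict_mem measurableSet_Ioo] with s hs
      rw [hfib]
      rw [integrable_indicator_iff measurableSet_Ioi, IntegrableOn,
        Measure.restrict_restrict measurableSet_Ioi,
        inter_eq_left.2 (Ioi_subset_Ioi (sub_nonneg.2 hs.2.le))]
      exact (integrableOn_mul_rpow_Ioi hα (sub_pos.2 hs.2)).smul_const _
    · refine hi.norm.congr ?_
      filter_upwards [ae_restrict_mem measurableSet_Ioo] with s hs
      have hts := sub_pos.2 hs.2
      have h1 : (fun r => ‖Φ (r, s)‖) =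
          (Ioi (t - s)).indicator fun r => (α * r ^ (-α - 1)) * ‖g s‖ := by
        ext r
        have := congrFun (hfib s) r
        rw [this]
        by_cases hr : r ∈ Ioi (t - s)
        · rw [indicator_of_mem hr, indicator_of_mem hr, norm_smul, Real.norm_eq_abs, abs_of_nonneg]
          have : 0 < r := hts.trans hr
          positivity
        · rw [indicator_of_notMem hr, indicator_of_notMem hr, norm_zero]
      rw [h1, setIntegral_indicator measurableSet_Ioi,
        inter_eq_right.2 (Ioi_subset_Ioi hts.le), integral_mul_const,
        integral_mul_rpow_Ioi hα hts, norm_smul, Real.norm_eq_abs,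
        abs_of_nonneg (Real.rpow_nonneg hts.le _)]
  have hinner : ∀ r ∈ Ioi (0 : ℝ), ∫ s in Ioo ε t, Φ (r, s)
      = (α * r ^ (-α - 1)) • (u t - u (max (t - r) ε)) := by
    intro r hr
    have hr : 0 < r := hr
    have h1 : (fun s => Φ (r, s)) =
        (Ioi (t - r)).indicator fun s => (α * r ^ (-α - 1)) • g s := by
      ext s
      have : t - s < r ↔ t - r < s := by constructor <;> intro _ <;> linarith
      simp [hΦ, hA, indicator, this]
    have h2 : Ioo ε t ∩ Ioi (t - r) = Ioo (max (t - r) ε) t := by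
      ext s; simp only [mem_inter_iff, mem_Ioo, mem_Ioi, max_lt_iff]; tauto
    rw [h1, setIntegral_indicator measurableSet_Ioi, h2, integral_smul,
      h.sub_eq_setIntegral_Ioo hu (lt_max_of_lt_right hε.1) (max_lt (by linarith) hε.2)
      (hg.mono_set (Ioo_subset_Ioo_left (le_max_right _ _)))]
  constructor
  · exact hΦi.integral_prod_left.congr
      ((ae_restrict_mem measurableSet_Ioi).mono fun r hr => hinner r hr)
  · rw [← setIntegral_congr_fun measurableSet_Ioi hinner,
      integral_integral_swap (f := fun r s => Φ (r, s)) hΦi]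
    refine setIntegral_congr_fun measurableSet_Ioo fun s hs => ?_
    rw [hfib s, hfibint s hs, integral_smul_const, integral_mul_rpow_Ioi hα (sub_pos.2 hs.2)]

end Time

/-! ### Scalar Marchaud derivatives and the fractional Gronwall lemma. -/

section Time

/-- The Marchaud form `∫₀^∞ α r^(-α-1) (w(t) - w(t - r)) dr` of the fractional derivative, up to
the factor `Γ(1 - α)⁻¹`. -/
noncomputable def marchaud (α : ℝ) (w : ℝ → ℝ) (t : ℝ) : ℝ :=
  ∫ r in Ioi 0, (α * r ^ (-α - 1)) * (w t - w (t - r))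

/-- The common majorant for dominated convergence: near `0` it is of order `r^(-α)`, integrable as
`α < 1`; at infinity of order `r^(-α-1)`, integrable as `α > 0`. -/
lemma integrableOn_mul_rpow_mul_min {α : ℝ} (hα : α ∈ Ioo (0 : ℝ) 1) {L B : ℝ} (hL : 0 ≤ L)
    (hB : 0 ≤ B) : IntegrableOn (fun r => (α * r ^ (-α - 1)) * min (L * r) B) (Ioi 0) := by
  have hα0 := hα.1
  have hm : Measurable fun r : ℝ => (α * r ^ (-α - 1)) * min (L * r) B := by fun_prop
  rw [← Ioc_union_Ioi_eq_Ioi (zero_le_one' ℝ)]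
  refine IntegrableOn.union ?_ ?_
  · have h1 : IntegrableOn (fun r : ℝ => (α * L) * r ^ (-α)) (Ioc 0 1) := by
      have := intervalIntegral.intervalIntegrable_rpow' (a := 0) (b := 1) (r := -α)
        (by linarith [hα.2])
      rw [intervalIntegrable_iff_integrableOn_Ioc_of_le zero_le_one] at this
      exact this.const_mul _
    refine h1.mono' hm.aestronglyMeasurable ?_
    filter_upwards [ae_restrict_mem measurableSet_Ioc] with r hr
    have hr0 : 0 < r := hr.1
    have : r ^ (-α) = r ^ (-α - 1) * r := by
      rw [← Real.rpow_add_one hr0.ne']; ring_nf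
    rw [Real.norm_eq_abs, abs_of_nonneg (by positivity), this]
    calc α * r ^ (-α - 1) * min (L * r) B ≤ α * r ^ (-α - 1) * (L * r) := by
          gcongr; exact min_le_left _ _
      _ = _ := by ring
  · refine ((integrableOn_mul_rpow_Ioi hα0 one_pos).mul_const B).mono'
      hm.aestronglyMeasurable ?_
    filter_upwards [ae_restrict_mem measurableSet_Ioi] with r hr
    have hr0 : (0 : ℝ) < r := one_pos.trans hr
    rw [Real.norm_eq_abs, abs_of_nonneg (by positivity)]
    gcongr
    exact min_le_right _ _

/-- For `r ≤ τ/2` both times lie in `[τ/2, T]`, where `w` is Lipschitz; for larger `r` the bound `B`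
is itself at most `(2B/τ) r`. The constant is uniform in `t ≥ τ`. -/
lemma exists_abs_sub_le_min {T B : ℝ} {w : ℝ → ℝ}
    (hw0 : ∀ s, 0 ≤ w s) (hwB : ∀ s, w s ≤ B)
    (hL : ∀ ε ∈ Ioo 0 T, ∃ L, LipschitzOnWith L w (Icc ε T)) {τ : ℝ} (hτ : τ ∈ Ioc 0 T) :
    ∃ L, 0 ≤ L ∧ ∀ t ∈ Icc τ T, ∀ r, 0 < r → |w t - w (t - r)| ≤ min (L * r) B := by
  obtain ⟨L, hL⟩ := hL (τ / 2) ⟨half_pos hτ.1, by linarith [hτ.1, hτ.2]⟩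
  have hB0 : 0 ≤ B := (hw0 0).trans (hwB 0)
  have hτ0 := hτ.1
  refine ⟨max L (2 * B / τ), le_max_of_le_left L.2, fun t ht r hr => ?_⟩
  have hB : |w t - w (t - r)| ≤ B := by
    rw [abs_le]; constructor <;> linarith [hw0 t, hw0 (t - r), hwB t, hwB (t - r)]
  refine le_min ?_ hB
  rcases le_total r (τ / 2) with h | h
  · have h1 := hL.dist_le_mul t ⟨by linarith [ht.1], ht.2⟩ (t - r)
      ⟨by linarith [ht.1], by linarith [ht.2]⟩
    rw [Real.dist_eq, Real.dist_eq, sub_sub_cancel, abs_of_pos hr] at h1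
    exact h1.trans (by gcongr; exact le_max_left _ _)
  · calc |w t - w (t - r)| ≤ B := hB
      _ = 2 * B / τ * (τ / 2) := by field_simp
      _ ≤ _ := by gcongr; exact le_max_right _ _

lemma integrableOn_marchaud {α : ℝ} (hα : α ∈ Ioo (0 : ℝ) 1) {T B : ℝ} {w : ℝ → ℝ}
    (hw : Continuous w) (hw0 : ∀ s, 0 ≤ w s) (hwB : ∀ s, w s ≤ B)
    (hL : ∀ ε ∈ Ioo 0 T, ∃ L, LipschitzOnWith L w (Icc ε T)) {t : ℝ} (ht : t ∈ Ioc 0 T) :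
    IntegrableOn (fun r => (α * r ^ (-α - 1)) * (w t - w (t - r))) (Ioi 0) := by
  obtain ⟨L, hL0, hL⟩ := exists_abs_sub_le_min hw0 hwB hL ht
  have hα0 := hα.1
  refine (integrableOn_mul_rpow_mul_min hα hL0 ((hw0 0).trans (hwB 0))).mono'
    (by fun_prop : Measurable _).aestronglyMeasurable ?_
  filter_upwards [ae_restrict_mem measurableSet_Ioi] with r hr
  have hr : 0 < r := hr
  rw [norm_mul, Real.norm_eq_abs, abs_of_nonneg (by positivity)]
  gcongr
  exact hL t ⟨le_rfl, ht.2⟩ r hr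

/-- Continuity is what upgrades an inequality valid for almost every time to the particular time
used in the Gronwall argument. -/
lemma continuousOn_marchaud {α : ℝ} (hα : α ∈ Ioo (0 : ℝ) 1) {T B : ℝ} {w : ℝ → ℝ}
    (hw : Continuous w) (hw0 : ∀ s, 0 ≤ w s) (hwB : ∀ s, w s ≤ B)
    (hL : ∀ ε ∈ Ioo 0 T, ∃ L, LipschitzOnWith L w (Icc ε T)) :
    ContinuousOn (marchaud α w) (Ioc 0 T) := by
  intro t₀ ht₀
  obtain ⟨L, hL0, hL⟩ := exists_abs_sub_le_min hw0 hwB hL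
    (τ := t₀ / 2) ⟨half_pos ht₀.1, by linarith [ht₀.1, ht₀.2]⟩
  have hα0 := hα.1
  refine tendsto_integral_filter_of_dominated_convergence _ ?_ ?_
    (integrableOn_mul_rpow_mul_min hα hL0 ((hw0 0).trans (hwB 0))) ?_
  · filter_upwards with t
    exact (by fun_prop : Measurable _).aestronglyMeasurable
  · filter_upwards [self_mem_nhdsWithin, nhdsWithin_le_nhds
      (Ioi_mem_nhds (by linarith [ht₀.1] : t₀ / 2 < t₀))] with t ht ht'
    filter_upwards [ae_restrict_mem measurableSet_Ioi] with r hr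
    have hr : 0 < r := hr
    rw [norm_mul, Real.norm_eq_abs, abs_of_nonneg (by positivity)]
    gcongr
    exact hL t ⟨le_of_lt ht', ht.2⟩ r hr
  · filter_upwards with r
    exact ((by fun_prop : Continuous fun t => (α * r ^ (-α - 1)) * (w t - w (t - r))).tendsto
      t₀).mono_left nhdsWithin_le_nhds

/-- A failure at `t` would persist on an interval to the left of `t`, a set of positive measure;
approaching from the left includes `t = T`. -/
lemma le_on_Ioc_of_ae_le {T : ℝ} {f g : ℝ → ℝ} (hf : ContinuousOn f (Ioc 0 T))
    (hg : ContinuousOn g (Ioc 0 T)) (h : ∀ᵐ t ∂volume.restrict (Ioo 0 T), f t ≤ g t)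
    {t : ℝ} (ht : t ∈ Ioc 0 T) : f t ≤ g t := by
  by_contra! hlt
  have hnhds : ∀ᶠ s in 𝓝[<] t, g s < f s := by
    have h1 : 𝓝[<] t ≤ 𝓝[Ioc 0 T] t := by
      rw [← nhdsWithin_Ioo_eq_nhdsLT ht.1]
      exact nhdsWithin_mono _ fun s hs => ⟨hs.1, hs.2.le.trans ht.2⟩
    exact h1 ((hg t ht).eventually_lt (hf t ht) hlt)
  obtain ⟨c, hc, hsub⟩ := (mem_nhdsLT_iff_exists_Ioo_subset' ht.1).1 hnhds
  have h0 : volume (Ioo (max c 0) t) = 0 := by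
    have h2 : ∀ᵐ s ∂volume.restrict (Ioo (max c 0) t), False := by
      have h3 := ae_restrict_of_ae_restrict_of_subset
        (Ioo_subset_Ioo (le_max_right c 0) ht.2) h
      filter_upwards [h3, ae_restrict_mem measurableSet_Ioo] with s hs hs'
      exact absurd (hsub ⟨(le_max_left _ _).trans_lt hs'.1, hs'.2⟩ : g s < f s) hs.not_gt
    exact Measure.restrict_eq_zero.1 (ae_eq_bot.1 (eventually_false_iff_eq_bot.1 h2))
  rw [Real.volume_Ioo, ENNReal.ofReal_eq_zero] at h0
  exact absurd (max_lt hc ht.1) (by linarith)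

/-- A fractional Gronwall lemma. -/
theorem eq_zero_of_mul_marchaud_le {α : ℝ} (hα : α ∈ Ioo (0 : ℝ) 1) {T B K : ℝ} {w : ℝ → ℝ}
    (hw : Continuous w) (hw0 : ∀ s, 0 ≤ w s) (hwB : ∀ s, w s ≤ B) (hwz : ∀ s ≤ 0, w s = 0)
    (hL : ∀ ε ∈ Ioo 0 T, ∃ L, LipschitzOnWith L w (Icc ε T))
    (hK : ∀ᵐ t ∂volume.restrict (Ioo 0 T), w t * marchaud α w t ≤ K * w t ^ 2)
    {t : ℝ} (ht : t ∈ Icc 0 T) : w t = 0 := by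
  have hα0 := hα.1
  -- The kernel has mass `δ^(-α)` on `(δ, ∞)`. There `w s - w (s - r)` will be at least `w s / 2`,
  -- so this choice yields the factor `|K| + 1 > K`.
  obtain ⟨δ, hδ, hδα⟩ : ∃ δ : ℝ, 0 < δ ∧ δ ^ (-α) = 2 * |K| + 2 := by
    refine ⟨(2 * |K| + 2) ^ (-α⁻¹), by positivity, ?_⟩
    rw [← Real.rpow_mul (by positivity), neg_mul_neg, inv_mul_cancel₀ hα0.ne', Real.rpow_one]
  obtain ⟨s, hs, hmax⟩ := isCompact_Icc.exists_isMaxOn ⟨t, ht⟩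
    (by fun_prop : Continuous fun t => w t * Real.exp (-(t / δ))).continuousOn (s := Icc 0 T)
  rcases (hw0 s).eq_or_lt' with hws | hws
  · have h1 : w t * Real.exp (-(t / δ)) ≤ w s * Real.exp (-(s / δ)) := hmax ht
    rw [hws, zero_mul] at h1
    exact le_antisymm (nonpos_of_mul_nonpos_left h1 (Real.exp_pos _)) (hw0 t)
  exfalso
  have hs0 : 0 < s := by
    by_contra! h
    exact hws.ne' (hwz s h)
  have hsT : s ∈ Ioc 0 T := ⟨hs0, hs.2⟩
  -- Maximality of `w · exp(-·/δ)` at `s`, for times in `[0, T]`; at earlier times `w` vanishes.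
  have hdecay : ∀ r, 0 < r → w (s - r) ≤ w s * Real.exp (-(r / δ)) := by
    intro r hr
    rcases le_total 0 (s - r) with h | h
    · have h1 : w (s - r) * Real.exp (-((s - r) / δ)) ≤ w s * Real.exp (-(s / δ)) :=
        hmax ⟨h, by linarith [hs.2]⟩
      have h2 : Real.exp (-(s / δ)) = Real.exp (-((s - r) / δ)) * Real.exp (-(r / δ)) := by
        rw [← Real.exp_add]; ring_nf
      rw [h2, mul_comm (Real.exp _), ← mul_assoc] at h1
      exact le_of_mul_le_mul_right h1 (Real.exp_pos _)
    · rw [hwz _ h]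
      positivity
  have hint := integrableOn_marchaud hα hw hw0 hwB hL hsT
  have hlow : w s * (|K| + 1) ≤ marchaud α w s := by
    calc w s * (|K| + 1) = ∫ r in Ioi δ, (α * r ^ (-α - 1)) * (w s / 2) := by
          rw [integral_mul_const, integral_mul_rpow_Ioi hα0 hδ, hδα]; ring
      _ ≤ ∫ r in Ioi δ, (α * r ^ (-α - 1)) * (w s - w (s - r)) := by
          refine setIntegral_mono_on ((integrableOn_mul_rpow_Ioi hα0 hδ).mul_const _)
            (hint.mono_set (Ioi_subset_Ioi hδ.le)) measurableSet_Ioi fun r hr => ?_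
          have hr' : δ < r := hr
          have hr0 : 0 < r := hδ.trans hr
          gcongr
          have h1 := hdecay r hr0
          have h2 : Real.exp (-(r / δ)) ≤ 1 / 2 := by
            have h3 : 1 < r / δ := (one_lt_div hδ).2 hr
            have h4 : 2 ≤ Real.exp (r / δ) := by linarith [Real.add_one_le_exp (r / δ)]
            rw [Real.exp_neg, one_div]
            exact inv_anti₀ two_pos h4
          nlinarith
      _ ≤ marchaud α w s := by
          refine setIntegral_mono_set hint ?_ (Ioi_subset_Ioi hδ.le).eventuallyLE
          filter_upwards [ae_restrict_mem measurableSet_Ioi] with r hr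
          have hr0 : 0 < r := hr
          have h1 : w (s - r) ≤ w s := (hdecay r hr0).trans
            (mul_le_of_le_one_right hws.le (Real.exp_le_one_iff.2 (by
              have : 0 < r / δ := by positivity
              linarith)))
          exact mul_nonneg (by positivity) (sub_nonneg.2 h1)
  have hup : w s * marchaud α w s ≤ K * w s ^ 2 :=
    le_on_Ioc_of_ae_le (f := fun t => w t * marchaud α w t) (g := fun t => K * w t ^ 2)
      (hw.continuousOn.mul (continuousOn_marchaud hα hw hw0 hwB hL))
      (by fun_prop) hK hsT
  have h1 : w s * (w s * (|K| + 1)) ≤ K * w s ^ 2 :=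
    (mul_le_mul_of_nonneg_left hlow hws.le).trans hup
  have h2 : 0 < w s ^ 2 := by positivity
  nlinarith [le_abs_self K]

end Time

/-! ### Weak gradients vanish on zero sets. -/

section Space

variable {d : ℕ}

/-- Translations act continuously on `L¹`. -/
lemma tendsto_integral_norm_translate_sub {k : EuclideanSpace ℝ (Fin d) → ℝ}
    (hk : Integrable k) :
    Tendsto (fun v => ∫ x, ‖k (x + v) - k x‖) (𝓝 0) (𝓝 0) := by
  have hmp : ∀ v : EuclideanSpace ℝ (Fin d),
      MeasurePreserving (fun x => x + v) volume volume := measurePreserving_add_right volume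
  -- Translations form a continuous family in the compact-open topology, which is what continuity of
  -- composition on `Lp` requires.
  let g : EuclideanSpace ℝ (Fin d) → C(EuclideanSpace ℝ (Fin d), EuclideanSpace ℝ (Fin d)) :=
    (ContinuousMap.mk (fun p : EuclideanSpace ℝ (Fin d) × EuclideanSpace ℝ (Fin d) => p.2 + p.1)
      (by fun_prop)).curry
  have hg : Continuous g := ContinuousMap.continuous _
  have hgm : ∀ v, MeasurePreserving (g v) volume volume := hmp
  have hc := (continuous_const (y := hk.toL1 k)).compMeasurePreservingLp hg hgm ENNReal.one_ne_top
  have h0 := (hc.sub (continuous_const (y := hk.toL1 k))).norm.tendsto 0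
  have hval : ∀ v, ‖Lp.compMeasurePreserving (g v) (hgm v) (hk.toL1 k) - hk.toL1 k‖
      = ∫ x, ‖k (x + v) - k x‖ := by
    intro v
    rw [L1.norm_eq_integral_norm]
    refine integral_congr_ae ?_
    filter_upwards [Lp.coeFn_sub (Lp.compMeasurePreserving (g v) (hgm v) (hk.toL1 k)) (hk.toL1 k),
      Lp.coeFn_compMeasurePreserving (hk.toL1 k) (hgm v), hk.coeFn_toL1,
      (hgm v).quasiMeasurePreserving.ae hk.coeFn_toL1] with x h1 h2 h3 h4
    rw [h1, Pi.sub_apply, h2, h3, Function.comp_apply, h4]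
    rfl
  have hz : (∫ x, ‖k (x + 0) - k x‖) = 0 := by simp
  rw [← hz]
  refine (tendsto_congr hval).1 ?_
  rw [← hval 0]
  exact h0

/-- The points of `Ω` at distance more than `δ` from the complement of `Ω`. -/
def erosion (Ω : Set (EuclideanSpace ℝ (Fin d))) (δ : ℝ) : Set (EuclideanSpace ℝ (Fin d)) :=
  {x | ENNReal.ofReal δ < Metric.infEDist x Ωᶜ}

lemma isOpen_erosion (Ω : Set (EuclideanSpace ℝ (Fin d))) (δ : ℝ) : IsOpen (erosion Ω δ) :=
  isOpen_lt continuous_const Metric.continuous_infEDist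

lemma add_mem_of_mem_erosion {Ω : Set (EuclideanSpace ℝ (Fin d))} {δ : ℝ}
    {x v : EuclideanSpace ℝ (Fin d)} (hx : x ∈ erosion Ω δ) (hv : ‖v‖ ≤ δ) : x + v ∈ Ω := by
  by_contra h
  have h1 : Metric.infEDist x Ωᶜ ≤ edist x (x + v) := Metric.infEDist_le_edist_of_mem h
  have h2 : edist x (x + v) ≤ ENNReal.ofReal δ := by
    rw [edist_dist]
    exact ENNReal.ofReal_le_ofReal (by simpa using hv)
  exact absurd hx (not_lt.2 (h1.trans h2))

lemma exists_mem_erosion {Ω : Set (EuclideanSpace ℝ (Fin d))} (hΩ : IsOpen Ω)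
    {x : EuclideanSpace ℝ (Fin d)} (hx : x ∈ Ω) : ∃ n : ℕ, x ∈ erosion Ω (1 / ((n : ℝ) + 1)) := by
  have hpos : 0 < Metric.infEDist x Ωᶜ := by
    rw [pos_iff_ne_zero]
    intro h0
    have := Metric.mem_closure_iff_infEDist_zero.2 h0
    rw [hΩ.isClosed_compl.closure_eq] at this
    exact this hx
  have h1 : Tendsto (fun n : ℕ => ENNReal.ofReal (1 / ((n : ℝ) + 1))) atTop (𝓝 0) := by
    simpa using ENNReal.tendsto_ofReal tendsto_one_div_add_atTop_nhds_zero_nat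
  exact (h1.eventually (gt_mem_nhds hpos)).exists

lemma IsTestFun.translate {Ω : Set (EuclideanSpace ℝ (Fin d))} {δ : ℝ}
    {φ : EuclideanSpace ℝ (Fin d) → ℝ} (hφ : ContDiff ℝ ∞ φ) (hφc : HasCompactSupport φ)
    (hφs : tsupport φ ⊆ erosion Ω δ) {v : EuclideanSpace ℝ (Fin d)} (hv : ‖v‖ ≤ δ) :
    IsTestFun Ω fun x => φ (x - v) := by
  refine ⟨hφ.comp (contDiff_id.sub contDiff_const), ?_, ?_⟩
  · exact hφc.comp_homeomorph (Homeomorph.subRight v)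
  · intro x hx
    have h1 : x - v ∈ tsupport φ :=
      tsupport_comp_subset_preimage φ (f := fun x => x - v) (by fun_prop) hx
    simpa using add_mem_of_mem_erosion (hφs h1) hv

lemma pderiv_translate (i : Fin d) (φ : EuclideanSpace ℝ (Fin d) → ℝ)
    (v x : EuclideanSpace ℝ (Fin d)) : pderiv i (fun x => φ (x - v)) x = pderiv i φ (x - v) := by
  unfold pderiv
  rw [fderiv_comp_sub]

lemma sub_translate_eq_integral_pderiv {φ : EuclideanSpace ℝ (Fin d) → ℝ} (hφ : ContDiff ℝ ∞ φ)
    (i : Fin d) (x : EuclideanSpace ℝ (Fin d)) {h : ℝ} (hh : 0 ≤ h) :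
    φ x - φ (x - h • EuclideanSpace.single i (1 : ℝ))
      = ∫ s in Ioc 0 h, pderiv i φ (x - s • EuclideanSpace.single i (1 : ℝ)) := by
  set e := EuclideanSpace.single i (1 : ℝ) with he
  have hder : ∀ s : ℝ, HasDerivAt (fun s => - φ (x - s • e)) (pderiv i φ (x - s • e)) s := by
    intro s
    have h1 : HasDerivAt (fun s : ℝ => x - s • e) (-e) s := by
      simpa using ((hasDerivAt_id s).smul_const e).const_sub x
    have h2 := (hφ.differentiable (by simp) (x - s • e)).hasFDerivAt.comp_hasDerivAt s h1
    simpa [pderiv, he] using! h2.neg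
  have hc : Continuous fun s : ℝ => pderiv i φ (x - s • e) := by
    have := hφ.continuous_fderiv (by simp)
    unfold pderiv
    fun_prop
  rw [← intervalIntegral.integral_of_le hh,
    intervalIntegral.integral_eq_sub_of_hasDerivAt (fun s _ => hder s)
      (hc.intervalIntegrable _ _)]
  simp
  ring

lemma integrable_translate_prod {k : EuclideanSpace ℝ (Fin d) → ℝ} (hk : Integrable k)
    (hkm : StronglyMeasurable k) (e : EuclideanSpace ℝ (Fin d)) (h : ℝ) :
    Integrable (fun p : EuclideanSpace ℝ (Fin d) × ℝ => k (p.1 + p.2 • e))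
      (volume.prod (volume.restrict (Ioc 0 h))) := by
  have hm : StronglyMeasurable fun p : EuclideanSpace ℝ (Fin d) × ℝ => k (p.1 + p.2 • e) :=
    hkm.comp_measurable (by fun_prop)
  rw [integrable_prod_iff' hm.aestronglyMeasurable]
  refine ⟨Eventually.of_forall fun s => hk.comp_add_right (s • e), ?_⟩
  have : (fun s : ℝ => ∫ x, ‖k (x + s • e)‖) = fun _ => ∫ x, ‖k x‖ := by
    ext s
    exact integral_add_right_eq_self (fun x => ‖k x‖) (s • e)
  simp only [this]
  exact integrable_const _

/-- An integrable function with an integrable weak partial derivative is, inside `Ω`, the integral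
of this derivative. -/
lemma ae_translate_sub_eq_integral {Ω : Set (EuclideanSpace ℝ (Fin d))} {i : Fin d}
    {f k : EuclideanSpace ℝ (Fin d) → ℝ} (hf : Integrable f) (hk : Integrable k)
    (hkm : StronglyMeasurable k)
    (hfk : ∀ φ, IsTestFun Ω φ → ∫ x, f x * pderiv i φ x = - ∫ x, k x * φ x)
    {δ h : ℝ} (hh : 0 ≤ h) (hhδ : h ≤ δ) :
    ∀ᵐ x, x ∈ erosion Ω δ → f (x + h • EuclideanSpace.single i (1 : ℝ)) - f x
      = ∫ s in Ioc 0 h, k (x + s • EuclideanSpace.single i (1 : ℝ)) := by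
  set e := EuclideanSpace.single i (1 : ℝ) with he
  have hnorm : ‖e‖ = 1 := by simp [he]
  have hkp := integrable_translate_prod hk hkm e h
  have hA : Integrable fun x => ∫ s in Ioc 0 h, k (x + s • e) := hkp.integral_prod_left
  have hD : Integrable fun x => f (x + h • e) - f x := (hf.comp_add_right (h • e)).sub hf
  -- By the fundamental lemma of the calculus of variations it suffices to test on the erosion,
  -- where every test function may be translated by `s • e`, `0 < s ≤ h ≤ δ`, without leaving `Ω`.
  have key := (isOpen_erosion Ω δ).ae_eq_zero_of_integral_contDiff_smul_eq_zero
    (f := fun x => (f (x + h • e) - f x) - ∫ s in Ioc 0 h, k (x + s • e)) (μ := volume)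
    ((hD.sub hA).locallyIntegrable.locallyIntegrableOn _) ?_
  · filter_upwards [key] with x hx hxm
    exact sub_eq_zero.1 (hx hxm)
  intro φ hφ hφc hφs
  obtain ⟨Cφ, hCφ⟩ := hφc.exists_bound_of_continuous hφ.continuous
  have hpc : Continuous (pderiv i φ) := by
    have := hφ.continuous_fderiv (by simp)
    unfold pderiv
    fun_prop
  obtain ⟨Cp, hCp⟩ : ∃ C, ∀ x, ‖pderiv i φ x‖ ≤ C := by
    obtain ⟨C, hC⟩ := (hφc.fderiv ℝ).exists_bound_of_continuous (hφ.continuous_fderiv (by simp))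
    refine ⟨C, fun x => ((fderiv ℝ φ x).le_opNorm _).trans ?_⟩
    rw [hnorm, mul_one]
    exact hC x
  have hφD : Integrable fun x => φ x * (f (x + h • e) - f x) :=
    hD.bdd_mul hφ.continuous.aestronglyMeasurable (Eventually.of_forall hCφ)
  have hφA : Integrable fun x => φ x * ∫ s in Ioc 0 h, k (x + s • e) :=
    hA.bdd_mul hφ.continuous.aestronglyMeasurable (Eventually.of_forall hCφ)
  have hbm : ∀ v, Integrable fun x => φ (x - v) * f x := fun v =>
    hf.bdd_mul (hφ.continuous.comp (by fun_prop)).aestronglyMeasurable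
      (Eventually.of_forall fun x => hCφ _)
  have h1 : ∫ x, φ x * (f (x + h • e) - f x)
      = - ∫ x, ∫ s in Ioc 0 h, f x * pderiv i φ (x - s • e) := by
    have ha : Integrable fun x => φ x * f (x + h • e) := by
      simpa using (hbm (h • e)).comp_add_right (h • e)
    have hb : Integrable fun x => φ x * f x := by simpa using hbm 0
    calc ∫ x, φ x * (f (x + h • e) - f x)
        = (∫ x, φ x * f (x + h • e)) - ∫ x, φ x * f x := by
          simp_rw [mul_sub]
          exact integral_sub ha hb
      _ = (∫ x, φ (x - h • e) * f x) - ∫ x, φ x * f x := by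
          rw [← integral_add_right_eq_self (fun x => φ (x - h • e) * f x) (h • e)]
          simp
      _ = - ∫ x, f x * (φ x - φ (x - h • e)) := by
          rw [← integral_sub (hbm _) hb, ← integral_neg]
          congr 1; ext x; ring
      _ = _ := by
          simp_rw [he, sub_translate_eq_integral_pderiv hφ i _ hh, integral_const_mul]
  have h2 : ∫ x, ∫ s in Ioc 0 h, f x * pderiv i φ (x - s • e)
      = ∫ s in Ioc 0 h, ∫ x, f x * pderiv i φ (x - s • e) := by
    refine integral_integral_swap (f := fun x s => f x * pderiv i φ (x - s • e)) ?_
    exact (hf.comp_fst (volume.restrict (Ioc 0 h))).mul_bdd (c := Cp)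
      (hpc.comp (by fun_prop)).aestronglyMeasurable (Eventually.of_forall fun p => hCp _)
  have h3 : ∀ s ∈ Ioc 0 h, ∫ x, f x * pderiv i φ (x - s • e)
      = - ∫ x, φ x * k (x + s • e) := by
    intro s hs
    have hv : ‖s • e‖ ≤ δ := by
      rw [norm_smul, hnorm, mul_one, Real.norm_eq_abs, abs_of_pos hs.1]
      exact hs.2.trans hhδ
    have := hfk _ (IsTestFun.translate hφ hφc hφs hv)
    simp_rw [pderiv_translate] at this
    rw [this, ← integral_add_right_eq_self (fun x => k x * φ (x - s • e)) (s • e)]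
    simp [mul_comm]
  have h4 : ∫ s in Ioc 0 h, ∫ x, φ x * k (x + s • e)
      = ∫ x, φ x * ∫ s in Ioc 0 h, k (x + s • e) := by
    simp_rw [← integral_const_mul]
    refine (integral_integral_swap (f := fun x s => φ x * k (x + s • e)) ?_).symm
    exact hkp.bdd_mul (c := Cφ) (hφ.continuous.comp continuous_fst).aestronglyMeasurable
      (Eventually.of_forall fun p => hCφ _)
  simp_rw [smul_eq_mul, mul_sub] at hφD hφA ⊢
  rw [integral_sub hφD hφA]
  simp_rw [← mul_sub]
  rw [h1, h2, setIntegral_congr_fun measurableSet_Ioc h3, integral_neg, h4]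
  ring

/-- By Fubini, the `L¹` distance between an average of translates and `k` is controlled by the `L¹`
moduli of the single translates. -/
lemma integral_norm_integral_translate_sub_le {k : EuclideanSpace ℝ (Fin d) → ℝ}
    (hk : Integrable k) (hkm : StronglyMeasurable k) (e : EuclideanSpace ℝ (Fin d)) {h η : ℝ}
    (hh : 0 ≤ h) (hη : ∀ s ∈ Ioc 0 h, ∫ x, ‖k (x + s • e) - k x‖ ≤ η) :
    Integrable (fun x => (∫ s in Ioc 0 h, k (x + s • e)) - h * k x) ∧
    ∫ x, ‖(∫ s in Ioc 0 h, k (x + s • e)) - h * k x‖ ≤ h * η := by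
  have hkp := integrable_translate_prod hk hkm e h
  have hk1 : Integrable (fun p : EuclideanSpace ℝ (Fin d) × ℝ => k p.1)
      (volume.prod (volume.restrict (Ioc 0 h))) := hk.comp_fst _
  have hd := hkp.sub hk1
  refine ⟨hkp.integral_prod_left.sub (hk.const_mul h), ?_⟩
  have h1 : ∀ᵐ x, (∫ s in Ioc 0 h, k (x + s • e)) - h * k x
      = ∫ s in Ioc 0 h, (k (x + s • e) - k x) := by
    filter_upwards [hkp.prod_right_ae] with x hx
    rw [integral_sub hx (integrable_const _)]
    simp [hh, Measure.real]
  calc ∫ x, ‖(∫ s in Ioc 0 h, k (x + s • e)) - h * k x‖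
      ≤ ∫ x, ∫ s in Ioc 0 h, ‖k (x + s • e) - k x‖ := by
        refine integral_mono_ae (hkp.integral_prod_left.sub (hk.const_mul h)).norm
          hd.norm.integral_prod_left ?_
        filter_upwards [h1] with x hx
        rw [hx]
        exact norm_integral_le_integral_norm _
    _ = ∫ s in Ioc 0 h, ∫ x, ‖k (x + s • e) - k x‖ :=
        integral_integral_swap (f := fun x s => ‖k (x + s • e) - k x‖) hd.norm
    _ ≤ ∫ s in Ioc 0 h, η := setIntegral_mono_on hd.norm.integral_prod_right
        (integrable_const _) measurableSet_Ioc hη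
    _ = h * η := by simp [hh, Measure.real]

/-- A weak partial derivative of `f` vanishes almost everywhere on the zero set of `f`. -/
theorem ae_eq_zero_of_eq_zero_of_integral {Ω : Set (EuclideanSpace ℝ (Fin d))} (hΩ : IsOpen Ω)
    {i : Fin d} {f k : EuclideanSpace ℝ (Fin d) → ℝ} (hf : Integrable f) (hk : Integrable k)
    (hfm : StronglyMeasurable f) (hkm : StronglyMeasurable k)
    (hfk : ∀ φ, IsTestFun Ω φ → ∫ x, f x * pderiv i φ x = - ∫ x, k x * φ x) :
    ∀ᵐ x, x ∈ Ω → f x = 0 → k x = 0 := by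
  set e := EuclideanSpace.single i (1 : ℝ) with he
  set Z : Set (EuclideanSpace ℝ (Fin d)) := {x | f x = 0} with hZ
  have hZm : MeasurableSet Z := measurableSet_eq_fun hfm.measurable measurable_const
  have main : ∀ δ : ℝ, 0 < δ → ∀ᵐ x, x ∈ erosion Ω δ → f x = 0 → k x = 0 := by
    intro δ hδ
    have hVm : MeasurableSet (erosion Ω δ ∩ Z) := (isOpen_erosion Ω δ).measurableSet.inter hZm
    set F : EuclideanSpace ℝ (Fin d) → ℝ := (erosion Ω δ ∩ Z).indicator fun x => ‖k x‖ with hF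
    have hFi : Integrable F := hk.norm.indicator hVm
    have hF0 : ∀ x, 0 ≤ F x := fun x => indicator_nonneg (fun _ _ => norm_nonneg _) _
    have hle : ∀ η : ℝ, 0 < η → ∫ x, F x ≤ 2 * η := by
      intro η hη
      have hcont : Tendsto (fun s : ℝ => s • e) (𝓝 0) (𝓝 0) := by
        simpa using (by fun_prop : Continuous fun s : ℝ => s • e).tendsto 0
      have hk0 := ((tendsto_integral_norm_translate_sub hk).comp hcont).eventually
        (gt_mem_nhds hη)
      have hF0' := ((tendsto_integral_norm_translate_sub hFi).comp hcont).eventually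
        (gt_mem_nhds hη)
      obtain ⟨r, hr, hball⟩ := Metric.eventually_nhds_iff.1 (hk0.and hF0')
      set h := min δ (r / 2) with hh
      have hh0 : 0 < h := lt_min hδ (half_pos hr)
      have hhr : h < r := (min_le_right _ _).trans_lt (half_lt_self hr)
      have hdist : ∀ s ∈ Ioc 0 h, dist s 0 < r := fun s hs => by
        rw [Real.dist_eq, sub_zero, abs_of_pos hs.1]
        exact hs.2.trans_lt hhr
      obtain ⟨hI, hIle⟩ := integral_norm_integral_translate_sub_le hk hkm e hh0.le
        fun s hs => (hball (hdist s hs)).1.le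
      have hFt : ∫ x, ‖F (x + h • e) - F x‖ ≤ η := (hball (hdist h (right_mem_Ioc.2 hh0))).2.le
      -- If `f` vanishes at both `x` and `x + h • e`, the average of `k` between them is zero, so
      -- `|k x|` is at most the averaging error. Otherwise `F` vanishes at `x + h • e`, and `F x` is
      -- its own translation error. Both errors are small in `L¹`.
      have hpt : ∀ᵐ x, F x ≤ ‖F (x + h • e) - F x‖
          + h⁻¹ * ‖(∫ s in Ioc 0 h, k (x + s • e)) - h * k x‖ := by
        have ht := ae_translate_sub_eq_integral hf hk hkm hfk hh0.le (min_le_left δ (r / 2))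
        filter_upwards [ht] with x hx
        by_cases hxV : x ∈ erosion Ω δ ∩ Z
        · by_cases hxh : x + h • e ∈ Z
          · have h1 : ∫ s in Ioc 0 h, k (x + s • e) = 0 := by
              rw [← hx hxV.1, show f (x + h • e) = 0 from hxh, show f x = 0 from hxV.2, sub_zero]
            rw [h1, zero_sub, norm_neg, norm_mul, Real.norm_of_nonneg hh0.le, ← mul_assoc,
              inv_mul_cancel₀ hh0.ne', one_mul, hF, indicator_of_mem hxV]
            exact le_add_of_nonneg_left (norm_nonneg _)
          · have h1 : F (x + h • e) = 0 := indicator_of_notMem (fun hV : x + h • e ∈ erosion Ω δ ∩ Z => hxh hV.2) _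
            rw [h1, zero_sub, norm_neg]
            exact le_add_of_le_of_nonneg (le_abs_self _) (by positivity)
        · rw [show F x = 0 from indicator_of_notMem hxV _]
          positivity
      have hFd : Integrable fun x => ‖F (x + h • e) - F x‖ :=
        ((hFi.comp_add_right (h • e)).sub hFi).norm
      calc ∫ x, F x ≤ ∫ x, (‖F (x + h • e) - F x‖
            + h⁻¹ * ‖(∫ s in Ioc 0 h, k (x + s • e)) - h * k x‖) :=
            integral_mono_ae hFi (hFd.add (hI.norm.const_mul _)) hpt
        _ = (∫ x, ‖F (x + h • e) - F x‖)
            + h⁻¹ * ∫ x, ‖(∫ s in Ioc 0 h, k (x + s • e)) - h * k x‖ := by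
            rw [integral_add hFd (hI.norm.const_mul _), integral_const_mul]
        _ ≤ η + h⁻¹ * (h * η) := by gcongr
        _ = 2 * η := by field_simp; ring
    have hF00 : ∫ x, F x = 0 := by
      refine le_antisymm (le_of_forall_pos_le_add fun η hη => ?_) (integral_nonneg hF0)
      have := hle (η / 2) (half_pos hη)
      linarith
    have hae := (integral_eq_zero_iff_of_nonneg hF0 hFi).1 hF00
    filter_upwards [hae] with x hx hxδ hfx
    have : F x = ‖k x‖ := indicator_of_mem (show x ∈ erosion Ω δ ∩ Z from ⟨hxδ, hfx⟩) _
    rw [hx] at this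
    simpa using this.symm
  have hall : ∀ᵐ x, ∀ n : ℕ, x ∈ erosion Ω (1 / ((n : ℝ) + 1)) → f x = 0 → k x = 0 :=
    ae_all_iff.2 fun n => main _ (by positivity)
  filter_upwards [hall] with x hx hxΩ
  obtain ⟨n, hn⟩ := exists_mem_erosion hΩ hxΩ
  exact hx n hn

/-- The weak gradient of an `H¹` function vanishes almost everywhere on its zero set. -/
theorem IsH1Grad.ae_grad_eq_zero {Ω : Set (EuclideanSpace ℝ (Fin d))} (hΩ : IsOpen Ω)
    (hΩb : Bornology.IsBounded Ω) {w : EuclideanSpace ℝ (Fin d) → ℝ}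
    {G : EuclideanSpace ℝ (Fin d) → EuclideanSpace ℝ (Fin d)} (h : IsH1Grad Ω w G) :
    ∀ᵐ x ∂volume.restrict Ω, w x = 0 → G x = 0 := by
  obtain ⟨hw, hG, hwG⟩ := h
  have : IsFiniteMeasure (volume.restrict Ω) := ⟨by simpa using hΩb.measure_lt_top⟩
  have hcomp : ∀ i : Fin d, ∀ᵐ x ∂volume.restrict Ω, w x = 0 → G x i = 0 := by
    intro i
    have hGi : Integrable (fun x => G x i) (volume.restrict Ω) :=
      (hG.integrable one_le_two).eval_piLp i
    have hwi : Integrable w (volume.restrict Ω) := hw.integrable one_le_two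
    -- The translation argument lives on the whole space, so strongly measurable representatives are
    -- extended by zero.
    set f := Ω.indicator (hwi.1.mk w) with hf
    set k := Ω.indicator (hGi.1.mk _) with hk
    have hfae : ∀ᵐ x ∂volume.restrict Ω, w x = f x := by
      filter_upwards [hwi.1.ae_eq_mk, ae_restrict_mem hΩ.measurableSet] with x hx hxΩ
      rw [hf, indicator_of_mem hxΩ, hx]
    have hkae : ∀ᵐ x ∂volume.restrict Ω, G x i = k x := by
      filter_upwards [hGi.1.ae_eq_mk, ae_restrict_mem hΩ.measurableSet] with x hx hxΩ
      rw [hk, indicator_of_mem hxΩ, hx]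
    have key := ae_eq_zero_of_eq_zero_of_integral hΩ (i := i) (f := f) (k := k)
      ((integrable_indicator_iff hΩ.measurableSet).2 (hwi.congr hwi.1.ae_eq_mk))
      ((integrable_indicator_iff hΩ.measurableSet).2 (hGi.congr hGi.1.ae_eq_mk))
      (hwi.1.stronglyMeasurable_mk.indicator hΩ.measurableSet)
      (hGi.1.stronglyMeasurable_mk.indicator hΩ.measurableSet) ?_
    · filter_upwards [hfae, hkae, ae_restrict_of_ae key, ae_restrict_mem hΩ.measurableSet]
        with x h1 h2 h3 h4 h5
      rw [h2]
      exact h3 h4 (by rw [← h1, h5])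
    · intro φ hφ
      have h1 := hwG φ hφ i
      have hout : ∀ ψ : EuclideanSpace ℝ (Fin d) → ℝ, ∀ F : EuclideanSpace ℝ (Fin d) → ℝ,
          ∫ x, Ω.indicator F x * ψ x = ∫ x in Ω, Ω.indicator F x * ψ x := fun ψ F =>
        (setIntegral_eq_integral_of_forall_compl_eq_zero fun x hx => by
          rw [indicator_of_notMem hx, zero_mul]).symm
      have h2 : ∫ x in Ω, f x * pderiv i φ x = ∫ x in Ω, w x * pderiv i φ x :=
        integral_congr_ae (hfae.mono fun x hx => by simp only [hx])
      have h3 : ∫ x in Ω, k x * φ x = ∫ x in Ω, G x i * φ x :=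
        integral_congr_ae (hkae.mono fun x hx => by simp only [hx])
      rw [hout, hout, h2, h3, h1]
  filter_upwards [ae_all_iff.2 hcomp] with x hx hwx
  ext i
  exact hx i hwx

/-! ### Pointwise ellipticity and the bilinear form tested with the positive part. -/

lemma minEigenvalue_pos (hd : 0 < d) {A : Matrix (Fin d) (Fin d) ℝ} (hA : A.PosDef) :
    0 < minEigenvalue A := by
  have : Nonempty (Fin d) := ⟨⟨0, hd⟩⟩
  unfold minEigenvalue
  rw [hA.1.spectrum_real_eq_range_eigenvalues]
  obtain ⟨i, hi⟩ := (range_nonempty hA.1.eigenvalues).csInf_mem (finite_range _)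
  rw [← hi]
  exact hA.eigenvalues_pos i

/-- Subtracting the minimal eigenvalue times the identity shifts the spectrum into `[0, ∞)`, so the
difference is positive semidefinite. -/
lemma minEigenvalue_mul_sum_sq_le {A : Matrix (Fin d) (Fin d) ℝ} (hA : A.IsHermitian)
    (ξ : Fin d → ℝ) :
    minEigenvalue A * ∑ i, ξ i ^ 2 ≤ ∑ i, ∑ j, A i j * ξ j * ξ i := by
  have hB : (A - algebraMap ℝ _ (minEigenvalue A)).PosSemidef := by
    rw [Matrix.posSemidef_iff_isHermitian_and_spectrum_nonneg]
    constructor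
    · refine hA.sub ?_
      rw [Matrix.algebraMap_eq_diagonal]
      exact Matrix.isHermitian_diagonal _
    · rw [← spectrum.sub_singleton_eq]
      rintro _ ⟨x, hx, y, rfl, rfl⟩
      have hbdd : BddBelow (spectrum ℝ A) := by
        rw [hA.spectrum_real_eq_range_eigenvalues]
        exact (finite_range _).bddBelow
      exact sub_nonneg.2 (csInf_le hbdd hx)
  have h := hB.dotProduct_mulVec_nonneg ξ
  rw [Matrix.sub_mulVec, dotProduct_sub, Algebra.algebraMap_eq_smul_one, Matrix.smul_mulVec,
    Matrix.one_mulVec, sub_nonneg] at h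
  calc minEigenvalue A * ∑ i, ξ i ^ 2 = star ξ ⬝ᵥ (minEigenvalue A • ξ) := by
        simp only [dotProduct, Finset.mul_sum, Pi.smul_apply, smul_eq_mul, Pi.star_apply,
          star_trivial]
        exact Finset.sum_congr rfl fun i _ => by ring
    _ ≤ star ξ ⬝ᵥ A.mulVec ξ := h
    _ = _ := by
        simp only [dotProduct, Matrix.mulVec, Finset.mul_sum, Pi.star_apply, star_trivial]
        exact Finset.sum_congr rfl fun i _ => Finset.sum_congr rfl fun j _ => by ring

/-- Completing the square in each coordinate: `m ξᵢ² + bᵢ ξᵢ s + bᵢ² s² / (4m)` is a square times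
`m`, which explains the `4` in the hypothesis. -/
lemma neg_mul_sq_le_form (hd : 0 < d) {A : Matrix (Fin d) (Fin d) ℝ} (hA : A.PosDef)
    {b : Fin d → ℝ} {C : ℝ} (hC : (∑ i, b i ^ 2) / (4 * minEigenvalue A) ≤ C) (ξ : Fin d → ℝ)
    (s : ℝ) :
    -(C * s ^ 2) ≤ (∑ i, ∑ j, A i j * ξ j * ξ i) + ∑ i, b i * ξ i * s := by
  have hm := minEigenvalue_pos hd hA
  set m := minEigenvalue A with hmdef
  have h1 := minEigenvalue_mul_sum_sq_le hA.1 ξ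
  have h2 : -((∑ i, b i ^ 2) / (4 * m) * s ^ 2) ≤ m * ∑ i, ξ i ^ 2 + ∑ i, b i * ξ i * s := by
    rw [Finset.sum_div, Finset.sum_mul, Finset.mul_sum, ← Finset.sum_neg_distrib,
      ← Finset.sum_add_distrib]
    refine Finset.sum_le_sum fun i _ => ?_
    have h3 : m * ξ i ^ 2 + b i * ξ i * s - -(b i ^ 2 / (4 * m) * s ^ 2)
        = m * (ξ i + b i * s / (2 * m)) ^ 2 := by
      field_simp; ring
    have h4 : 0 ≤ m * (ξ i + b i * s / (2 * m)) ^ 2 := by positivity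
    linarith
  have h3 : (∑ i, b i ^ 2) / (4 * m) * s ^ 2 ≤ C * s ^ 2 :=
    mul_le_mul_of_nonneg_right hC (sq_nonneg s)
  linarith

/-- Vanishing on zero sets is applied to `w⁺`, which is zero where `w ≤ 0`, and to `w⁺ - w`, which
is zero where `w ≥ 0`. -/
lemma ae_grad_posPart {Ω : Set (EuclideanSpace ℝ (Fin d))} (hΩ : IsOpen Ω)
    (hΩb : Bornology.IsBounded Ω) {w : EuclideanSpace ℝ (Fin d) → ℝ}
    {G H : EuclideanSpace ℝ (Fin d) → EuclideanSpace ℝ (Fin d)} (hG : IsH1Grad Ω w G)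
    (hH : IsH1Grad Ω (fun x => max 0 (w x)) H) :
    ∀ᵐ x ∂volume.restrict Ω, (w x ≤ 0 → H x = 0) ∧ (0 ≤ w x → H x = G x) := by
  have : IsFiniteMeasure (volume.restrict Ω) := ⟨by simpa using hΩb.measure_lt_top⟩
  have hsub : IsH1Grad Ω (fun x => max 0 (w x) - w x) (fun x => H x - G x) := by
    refine ⟨hH.1.sub hG.1, hH.2.1.sub hG.2.1, fun φ hφ i => ?_⟩
    obtain ⟨C, hC⟩ := hφ.2.1.exists_bound_of_continuous hφ.1.continuous
    have hdc := hφ.1.continuous_fderiv (by simp)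
    obtain ⟨C', hC'⟩ : ∃ C, ∀ x, ‖pderiv i φ x‖ ≤ C := by
      obtain ⟨C, hC⟩ := (hφ.2.1.fderiv ℝ).exists_bound_of_continuous hdc
      refine ⟨C, fun x => ((fderiv ℝ φ x).le_opNorm _).trans ?_⟩
      rw [PiLp.norm_single, norm_one, mul_one]
      exact hC x
    have hpc : Continuous (pderiv i φ) := by
      unfold pderiv
      fun_prop
    have i1 : ∀ f, Integrable f (volume.restrict Ω) →
        Integrable (fun x => f x * pderiv i φ x) (volume.restrict Ω) := fun f hf =>
      hf.mul_bdd (c := C') hpc.aestronglyMeasurable (Eventually.of_forall hC')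
    have i2 : ∀ f, Integrable f (volume.restrict Ω) →
        Integrable (fun x => f x * φ x) (volume.restrict Ω) := fun f hf =>
      hf.mul_bdd (c := C) hφ.1.continuous.aestronglyMeasurable (Eventually.of_forall hC)
    simp only [sub_mul, PiLp.sub_apply]
    rw [integral_sub (i1 _ (hH.1.integrable one_le_two)) (i1 _ (hG.1.integrable one_le_two)),
      integral_sub (i2 _ ((hH.2.1.eval_piLp i).integrable one_le_two))
        (i2 _ ((hG.2.1.eval_piLp i).integrable one_le_two)), hH.2.2 φ hφ i, hG.2.2 φ hφ i]
    ring
  filter_upwards [hH.ae_grad_eq_zero hΩ hΩb, hsub.ae_grad_eq_zero hΩ hΩb] with x h1 h2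
  exact ⟨fun h => h1 (max_eq_left h), fun h => sub_eq_zero.1 (h2 (by rw [max_eq_right h, sub_self]))⟩

/-- The elliptic part of the equation, tested with the positive part of the solution. -/
theorem neg_mul_integral_sq_le_form (hd : 0 < d) {Ω : Set (EuclideanSpace ℝ (Fin d))}
    (hΩ : IsOpen Ω) (hΩb : Bornology.IsBounded Ω)
    {a : EuclideanSpace ℝ (Fin d) → Matrix (Fin d) (Fin d) ℝ}
    {b : EuclideanSpace ℝ (Fin d) → Fin d → ℝ} {c : EuclideanSpace ℝ (Fin d) → ℝ}
    (ha : ∀ i j, MemLp (fun x => a x i j) ∞ (volume.restrict Ω))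
    (hb : ∀ i, MemLp (fun x => b x i) ∞ (volume.restrict Ω))
    (hpos : ∀ᵐ x ∂volume.restrict Ω, (a x).PosDef) {C lam : ℝ}
    (hC : ∀ᵐ x ∂volume.restrict Ω, (∑ i, b x i ^ 2) / (4 * minEigenvalue (a x)) ≤ C)
    (hc : ∀ᵐ x ∂volume.restrict Ω, -lam ≤ c x) {w : EuclideanSpace ℝ (Fin d) → ℝ}
    {G H : EuclideanSpace ℝ (Fin d) → EuclideanSpace ℝ (Fin d)} (hG : IsH1Grad Ω w G)
    (hH : IsH1Grad Ω (fun x => max 0 (w x)) H)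
    (hcw : IntegrableOn (fun x => c x * w x * max 0 (w x)) Ω) :
    -((C + lam) * ∫ x in Ω, max 0 (w x) ^ 2) ≤
      ((∫ x in Ω, ∑ i, ∑ j, a x i j * G x j * H x i)
        + ∫ x in Ω, ∑ i, b x i * G x i * max 0 (w x))
        + ∫ x in Ω, c x * w x * max 0 (w x) := by
  have hi1 : Integrable (fun x => ∑ i, ∑ j, a x i j * G x j * H x i) (volume.restrict Ω) := by
    refine integrable_finsetSum _ fun i _ => integrable_finsetSum _ fun j _ => ?_
    simp_rw [mul_assoc]
    exact ((hG.2.1.eval_piLp j).integrable_mul (hH.2.1.eval_piLp i)).mul_of_top_right (ha i j)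
  have hi2 : Integrable (fun x => ∑ i, b x i * G x i * max 0 (w x)) (volume.restrict Ω) := by
    refine integrable_finsetSum _ fun i _ => ?_
    simp_rw [mul_assoc]
    exact ((hG.2.1.eval_piLp i).integrable_mul hH.1).mul_of_top_right (hb i)
  have hi3 : Integrable (fun x => max 0 (w x) ^ 2) (volume.restrict Ω) := hH.1.integrable_sq
  have hi12 : Integrable (fun x => (∑ i, ∑ j, a x i j * G x j * H x i)
      + ∑ i, b x i * G x i * max 0 (w x)) (volume.restrict Ω) := hi1.add hi2
  rw [← integral_add hi1 hi2, ← integral_add hi12 hcw, ← integral_const_mul,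
    ← integral_neg]
  refine integral_mono_ae (hi3.const_mul _).neg (hi12.add hcw) ?_
  filter_upwards [hpos, hC, hc, ae_grad_posPart hΩ hΩb hG hH] with x h1 h2 h3 h4
  rcases le_total (w x) 0 with h | h
  · simp [h4.1 h, max_eq_left h]
  · rw [h4.2 h, max_eq_right h]
    have h5 := neg_mul_sq_le_form hd h1 h2 (fun i => G x i) (w x)
    have h6 : -lam * w x ^ 2 ≤ c x * w x ^ 2 := mul_le_mul_of_nonneg_right h3 (sq_nonneg _)
    linarith

end Space

/-! ### Time slices of the coefficients. -/

lemma ae_memLp_top_section {α β : Type*} [MeasurableSpace α] [MeasurableSpace β] {μ : Measure α}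
    {ν : Measure β} [SFinite μ] [SFinite ν] {F : α × β → ℝ} (hF : MemLp F ∞ (μ.prod ν)) :
    ∀ᵐ y ∂ν, MemLp (fun x => F (x, y)) ∞ μ := by
  have hbd : ∀ᵐ p ∂μ.prod ν, ‖F p‖ₑ ≤ eLpNormEssSup F (μ.prod ν) := ae_le_eLpNormEssSup
  have hbd' : ∀ᵐ y ∂ν, ∀ᵐ x ∂μ, ‖F (x, y)‖ₑ ≤ eLpNormEssSup F (μ.prod ν) :=
    Measure.ae_ae_of_ae_prod (Measure.measurePreserving_swap.quasiMeasurePreserving.ae hbd)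
  filter_upwards [hbd', hF.1.prodMk_right] with y h1 h2
  refine memLp_top_of_bound h2 (eLpNormEssSup F (μ.prod ν)).toReal ?_
  filter_upwards [h1] with x hx
  rw [← toReal_enorm]
  exact ENNReal.toReal_mono (by simpa using hF.eLpNorm_ne_top) hx

lemma ae_ae_section {α β : Type*} [MeasurableSpace α] [MeasurableSpace β] {μ : Measure α}
    {ν : Measure β} [SFinite μ] [SFinite ν] {P : α × β → Prop} (h : ∀ᵐ p ∂μ.prod ν, P p) :
    ∀ᵐ y ∂ν, ∀ᵐ x ∂μ, P (x, y) :=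
  Measure.ae_ae_of_ae_prod (Measure.measurePreserving_swap.quasiMeasurePreserving.ae h)

/-! ### Removing the truncation at `ε`. -/

section Time

/-- Truncation only shortens the time step from `r` to `t - ε` when `r > t - ε`, so the untruncated
majorant still dominates. In the limit, the value at time `0` agrees with that at negative times
because both are zero. -/
lemma tendsto_marchaud_truncated {α : ℝ} (hα : α ∈ Ioo (0 : ℝ) 1) {T B : ℝ} {w : ℝ → ℝ}
    (hw : Continuous w) (hw0 : ∀ s, 0 ≤ w s) (hwB : ∀ s, w s ≤ B) (hwz : ∀ s ≤ 0, w s = 0)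
    (hL : ∀ ε ∈ Ioo 0 T, ∃ L, LipschitzOnWith L w (Icc ε T)) {t : ℝ} (ht : t ∈ Ioc 0 T) :
    Tendsto (fun ε => ∫ r in Ioi 0, (α * r ^ (-α - 1)) * (w t - w (max (t - r) ε))) (𝓝[>] 0)
      (𝓝 (marchaud α w t)) := by
  obtain ⟨L, hL0, hL⟩ := exists_abs_sub_le_min hw0 hwB hL ht
  have hα0 := hα.1
  have hB0 := (hw0 0).trans (hwB 0)
  refine tendsto_integral_filter_of_dominated_convergence _ ?_ ?_
    (integrableOn_mul_rpow_mul_min hα hL0 hB0) ?_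
  · filter_upwards with ε
    exact (by fun_prop : Measurable _).aestronglyMeasurable
  · have h1 : ∀ᶠ ε in 𝓝[>] (0 : ℝ), ε < t := nhdsWithin_le_nhds (Iio_mem_nhds ht.1)
    filter_upwards [h1] with ε hεt
    filter_upwards [ae_restrict_mem measurableSet_Ioi] with r hr
    have hr : 0 < r := hr
    rw [norm_mul, Real.norm_eq_abs, abs_of_nonneg (by positivity)]
    gcongr
    rcases le_total ε (t - r) with h | h
    · rw [max_eq_left h]
      exact hL t ⟨le_rfl, ht.2⟩ r hr
    · rw [max_eq_right h]
      have h2 := hL t ⟨le_rfl, ht.2⟩ (t - ε) (sub_pos.2 hεt)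
      rw [sub_sub_cancel] at h2
      refine h2.trans (min_le_min_right _ ?_)
      gcongr
      linarith
  · filter_upwards with r
    have h1 := ((by fun_prop : Continuous fun ε => (α * r ^ (-α - 1)) *
      (w t - w (max (t - r) ε))).tendsto 0).mono_left (nhdsWithin_le_nhds (s := Ioi 0))
    have h2 : w (max (t - r) 0) = w (t - r) := by
      rcases le_total 0 (t - r) with h | h
      · rw [max_eq_left h]
      · rw [max_eq_right h, hwz _ h, hwz 0 le_rfl]
    rwa [h2] at h1

end Time

/-! ### Positive parts and duality between `L^∞` and `L¹`. -/

section PosPart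

variable {α : Type*} [MeasurableSpace α] {μ : Measure α}

lemma ae_abs_sub_le_norm_sub (f g : Lp ℝ ∞ μ) : ∀ᵐ x ∂μ, |f x - g x| ≤ ‖f - g‖ := by
  filter_upwards [Lp.coeFn_sub f g, ae_le_eLpNormEssSup (f := (f - g : Lp ℝ ∞ μ)) (μ := μ)]
    with x h1 h2
  rw [h1, Pi.sub_apply] at h2
  rw [← Real.norm_eq_abs, ← toReal_enorm, Lp.norm_def, eLpNorm_exponent_top]
  exact ENNReal.toReal_mono (by simpa using Lp.eLpNorm_ne_top (f - g)) h2

lemma integrable_mul_of_memLp_top (f : Lp ℝ ∞ μ) {χ : α → ℝ} (hχ : Integrable χ μ) :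
    Integrable (fun x => f x * χ x) μ :=
  hχ.mul_of_top_right (Lp.memLp f)

/-- Integration against an integrable function, as a functional on `L^∞`. -/
noncomputable def pairing {χ : α → ℝ} (hχ : Integrable χ μ) : Lp ℝ ∞ μ →L[ℝ] ℝ :=
  LinearMap.mkContinuous
    { toFun := fun f => ∫ x, f x * χ x ∂μ
      map_add' := fun f g => by
        rw [← integral_add (integrable_mul_of_memLp_top f hχ) (integrable_mul_of_memLp_top g hχ)]
        refine integral_congr_ae ?_
        filter_upwards [Lp.coeFn_add f g] with x hx
        rw [hx, Pi.add_apply, add_mul]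
      map_smul' := fun r f => by
        rw [RingHom.id_apply, smul_eq_mul, ← integral_const_mul]
        refine integral_congr_ae ?_
        filter_upwards [Lp.coeFn_smul r f] with x hx
        rw [hx, Pi.smul_apply, smul_eq_mul, mul_assoc] }
    (∫ x, ‖χ x‖ ∂μ) fun f => by
      rw [mul_comm, ← integral_const_mul]
      refine norm_integral_le_of_norm_le (hχ.norm.const_mul _) ?_
      filter_upwards [ae_abs_sub_le_norm_sub f 0, Lp.coeFn_zero ℝ ∞ μ] with x hx h0
      rw [h0, Pi.zero_apply, sub_zero, sub_zero] at hx
      rw [norm_mul]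
      exact mul_le_mul_of_nonneg_right hx (norm_nonneg _)

lemma pairing_apply {χ : α → ℝ} (hχ : Integrable χ μ) (f : Lp ℝ ∞ μ) :
    pairing hχ f = ∫ x, f x * χ x ∂μ := rfl

variable [IsFiniteMeasure μ]

lemma memLp_posPart (f : Lp ℝ ∞ μ) : MemLp (fun x => max 0 (f x)) 2 μ := by
  have h : MemLp (fun x => max (f x) 0) ∞ μ := (Lp.memLp f).pos_part
  simp_rw [max_comm (0 : ℝ)]
  exact h.mono_exponent le_top

/-- The positive part of an essentially bounded function, as a square integrable function. -/
noncomputable def posPartL2 (f : Lp ℝ ∞ μ) : Lp ℝ 2 μ := (memLp_posPart f).toLp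

lemma coeFn_posPartL2 (f : Lp ℝ ∞ μ) : posPartL2 f =ᵐ[μ] fun x => max 0 (f x) :=
  (memLp_posPart f).coeFn_toLp

lemma inner_posPartL2 (f g : Lp ℝ ∞ μ) :
    inner ℝ (posPartL2 f) (posPartL2 g) = ∫ x, max 0 (f x) * max 0 (g x) ∂μ := by
  rw [L2.inner_def]
  refine integral_congr_ae ?_
  filter_upwards [coeFn_posPartL2 f, coeFn_posPartL2 g] with x h1 h2
  rw [h1, h2]
  simp [mul_comm]

lemma norm_posPartL2_sq (f : Lp ℝ ∞ μ) : ‖posPartL2 f‖ ^ 2 = ∫ x, max 0 (f x) ^ 2 ∂μ := by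
  rw [← real_inner_self_eq_norm_sq, inner_posPartL2]
  simp_rw [pow_two]

/-- The positive part is pointwise 1-Lipschitz, and on a finite measure space the `L^∞` norm
controls the `L²` norm. -/
lemma exists_lipschitzWith_posPartL2 :
    ∃ C, LipschitzWith C (posPartL2 : Lp ℝ ∞ μ → Lp ℝ 2 μ) := by
  refine ⟨measureUnivNNReal μ ^ (2 : ℝ≥0∞).toReal⁻¹, LipschitzWith.of_dist_le_mul fun f g => ?_⟩
  rw [dist_eq_norm, dist_eq_norm, NNReal.coe_rpow]
  refine Lp.norm_le_of_ae_bound (norm_nonneg _) ?_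
  filter_upwards [ae_abs_sub_le_norm_sub f g, coeFn_posPartL2 f, coeFn_posPartL2 g,
    Lp.coeFn_sub (posPartL2 f) (posPartL2 g)] with x h1 h2 h3 h4
  rw [h4, Pi.sub_apply, h2, h3, Real.norm_eq_abs, max_comm 0, max_comm 0]
  exact (abs_max_sub_max_le_abs _ _ _).trans h1

lemma posPartL2_eq_zero_iff {f : Lp ℝ ∞ μ} : posPartL2 f = 0 ↔ ∀ᵐ x ∂μ, f x ≤ 0 := by
  rw [Lp.eq_zero_iff_ae_eq_zero]
  constructor
  · intro h
    filter_upwards [h, coeFn_posPartL2 f] with x h1 h2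
    rw [h1] at h2
    exact max_eq_left_iff.1 h2.symm
  · intro h
    filter_upwards [h, coeFn_posPartL2 f] with x h1 h2
    rw [h2, max_eq_left h1]
    rfl

/-- Here `f f⁺ = (f⁺)²`, while `g f⁺ ≤ g⁺ f⁺`, whose integral is bounded by Cauchy–Schwarz. -/
lemma norm_mul_sub_le_pairing (f g : Lp ℝ ∞ μ) :
    ‖posPartL2 f‖ * (‖posPartL2 f‖ - ‖posPartL2 g‖)
      ≤ pairing ((memLp_posPart f).integrable one_le_two) (f - g) := by
  rw [map_sub, mul_sub, ← pow_two, norm_posPartL2_sq, pairing_apply, pairing_apply]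
  have h1 : ∫ x, max 0 (f x) ^ 2 ∂μ = ∫ x, f x * max 0 (f x) ∂μ := by
    congr 1; ext x
    rcases le_total (f x) 0 with h | h
    · simp [max_eq_left h]
    · rw [max_eq_right h, pow_two]
  have h2 : ∫ x, g x * max 0 (f x) ∂μ ≤ ‖posPartL2 f‖ * ‖posPartL2 g‖ := by
    refine le_trans ?_ (real_inner_le_norm _ _)
    rw [inner_posPartL2]
    refine integral_mono
      (integrable_mul_of_memLp_top g ((memLp_posPart f).integrable one_le_two))
      ((memLp_posPart f).integrable_mul (memLp_posPart g)) fun x => ?_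
    simp only
    rw [mul_comm]
    exact mul_le_mul_of_nonneg_left (le_max_right _ _) (le_max_left _ _)
  rw [h1]
  linarith

end PosPart

/-! ### Testing the Caputo derivative with the positive part. -/

section Caputo

variable {β : Type*} [MeasurableSpace β] {μ : Measure β} [IsFiniteMeasure μ]

/-- The Caputo derivative, tested with the positive part of the function, dominates the Marchaud
derivative of the `L²` norm of the positive part. -/
theorem HasCaputoDeriv.mul_marchaud_le {α : ℝ} (hα : α ∈ Ioo (0 : ℝ) 1) {T B : ℝ}
    {u : ℝ → Lp ℝ ∞ μ} {w : ℝ → ℝ} (hu : ContinuousOn u (Icc 0 T))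
    (hwu : ∀ s ∈ Icc 0 T, w s = ‖posPartL2 (u s)‖)
    (hw : Continuous w) (hw0 : ∀ s, 0 ≤ w s) (hwB : ∀ s, w s ≤ B) (hwz : ∀ s ≤ 0, w s = 0)
    (hL : ∀ ε ∈ Ioo 0 T, ∃ L, LipschitzOnWith L w (Icc ε T)) {t : ℝ} (ht : t ∈ Ioc 0 T)
    {D : Lp ℝ ∞ μ} (hD : HasCaputoDeriv α u t D) :
    w t * marchaud α w t ≤ Real.Gamma (1 - α) * ∫ x, D x * max 0 (u t x) ∂μ := by
  obtain ⟨g, hg, hi, hlim⟩ := hD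
  have hα0 := hα.1
  have hut : ContinuousOn u (Icc 0 t) := hu.mono (Icc_subset_Icc_right ht.2)
  set ℓ := pairing ((memLp_posPart (u t)).integrable one_le_two) with hℓ
  have hΓ : Real.Gamma (1 - α) ≠ 0 := (Real.Gamma_pos_of_pos (by linarith [hα.2])).ne'
  -- Testing is a continuous functional on `L^∞`, so it commutes with the improper limit and with
  -- the Bochner integrals.
  have hlim' : Tendsto (fun ε => ℓ (∫ s in Ioo ε t, (t - s) ^ (-α) • g s)) (𝓝[>] 0)
      (𝓝 (Real.Gamma (1 - α) * ℓ D)) := by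
    have := ((ℓ.continuous.tendsto D).comp hlim).const_mul (Real.Gamma (1 - α))
    refine this.congr fun ε => ?_
    simp only [Function.comp_apply, map_smul, smul_eq_mul]
    rw [← mul_assoc, mul_inv_cancel₀ hΓ, one_mul]
  have hlimw := (tendsto_marchaud_truncated hα hw hw0 hwB hwz hL ht).const_mul (w t)
  obtain ⟨C, hC⟩ := exists_lipschitzWith_posPartL2 (μ := μ)
  have hlt : ∀ᶠ ε in 𝓝[>] (0 : ℝ), ε < t := nhdsWithin_le_nhds (Iio_mem_nhds ht.1)
  change _ ≤ Real.Gamma (1 - α) * ℓ D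
  refine le_of_tendsto_of_tendsto hlimw hlim' ?_
  filter_upwards [hlt, self_mem_nhdsWithin] with ε hεt hε
  have hε : 0 < ε := hε
  obtain ⟨hint, heq⟩ := hg.caputo_eq_marchaud hα0 hut ⟨hε, hεt⟩ (hi ε ⟨hε, hεt⟩)
  rw [heq, ← ℓ.integral_comp_comm hint, ← integral_const_mul]
  have hmem : ∀ r ∈ Ioi (0 : ℝ), max (t - r) ε ∈ Icc 0 T := fun r hr =>
    ⟨le_max_of_le_right hε.le, max_le (by linarith [ht.2, mem_Ioi.1 hr]) (hεt.le.trans ht.2)⟩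
  -- The Lipschitz bound for `posPartL2` transfers integrability from the vector-valued integrand to
  -- the scalar one.
  have hintw : IntegrableOn
      (fun r => (α * r ^ (-α - 1)) * (w t - w (max (t - r) ε))) (Ioi 0) := by
    refine (hint.norm.const_mul (C : ℝ)).mono' (by fun_prop : Measurable _).aestronglyMeasurable ?_
    filter_upwards [ae_restrict_mem measurableSet_Ioi] with r hr
    rw [hwu t ⟨ht.1.le, ht.2⟩, hwu _ (hmem r hr), norm_mul, norm_smul, mul_left_comm]
    gcongr
    refine (abs_norm_sub_norm_le _ _).trans ?_
    have := hC.dist_le_mul (u t) (u (max (t - r) ε))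
    rwa [dist_eq_norm, dist_eq_norm] at this
  refine setIntegral_mono_on (hintw.const_mul _) (ℓ.integrable_comp hint) measurableSet_Ioi
    fun r hr => ?_
  have hr0 : 0 < r := hr
  rw [map_smul, smul_eq_mul, mul_left_comm, hwu t ⟨ht.1.le, ht.2⟩, hwu _ (hmem r hr)]
  gcongr
  exact norm_mul_sub_le_pairing _ _

end Caputo

end FracMaxPrinciple

theorem theorem2 (d : ℕ) (hd : 0 < d)
    -- the domain, the final time and the order of the time derivative
    (Ω : Set (EuclideanSpace ℝ (Fin d))) (hΩo : IsOpen Ω) (hΩb : Bornology.IsBounded Ω)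
    (T : ℝ) (hT : 0 < T) (α : ℝ) (hα : α ∈ Ioo (0 : ℝ) 1)
    -- the coefficients of the elliptic operator, in `L^∞(Ω × (0,T))`
    (a : EuclideanSpace ℝ (Fin d) → ℝ → Matrix (Fin d) (Fin d) ℝ)
    (b : EuclideanSpace ℝ (Fin d) → ℝ → Fin d → ℝ)
    (ha : ∀ i j, MemLp (fun p : EuclideanSpace ℝ (Fin d) × ℝ => a p.1 p.2 i j) ∞
      ((volume.restrict Ω).prod (volume.restrict (Ioo 0 T))))
    (hb : ∀ i, MemLp (fun p : EuclideanSpace ℝ (Fin d) × ℝ => b p.1 p.2 i) ∞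
      ((volume.restrict Ω).prod (volume.restrict (Ioo 0 T))))
    -- `a` is symmetric positive definite
    (hpos : ∀ᵐ p ∂((volume.restrict Ω).prod (volume.restrict (Ioo 0 T))), (a p.1 p.2).PosDef)
    -- `sup |b|² / (4 λ_a) < ∞`
    (hC : ∃ C : ℝ, ∀ᵐ p ∂((volume.restrict Ω).prod (volume.restrict (Ioo 0 T))),
      (∑ i, b p.1 p.2 i ^ 2) / (4 * FracMaxPrinciple.minEigenvalue (a p.1 p.2)) ≤ C)
    -- the reaction coefficient, `inf c ≥ -lam` with `lam ≥ 0`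
    (c : EuclideanSpace ℝ (Fin d) → ℝ → ℝ) (lam : ℝ) (hlam : 0 ≤ lam)
    (hcm : AEStronglyMeasurable (fun p : EuclideanSpace ℝ (Fin d) × ℝ => c p.1 p.2)
      ((volume.restrict Ω).prod (volume.restrict (Ioo 0 T))))
    (hc : ∀ᵐ p ∂((volume.restrict Ω).prod (volume.restrict (Ioo 0 T))), -lam ≤ c p.1 p.2)
    -- regularity of `u`
    (u : ℝ → FracMaxPrinciple.LInfty Ω) (hu : ContinuousOn u (Icc 0 T))
    (hu' : ∀ ε t : ℝ, 0 < ε → ε < t → t ≤ T → FracMaxPrinciple.MemW1Infty ε t u)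
    (huH : ∀ t ∈ Ioc 0 T, FracMaxPrinciple.MemH1 Ω (u t))
    -- `u(·,0) ≤ 0` in `Ω` and `u(·,t) ≤ 0` on `∂Ω`
    (hu0 : ∀ᵐ x ∂(volume.restrict Ω), u 0 x ≤ 0)
    (hbd : ∀ t ∈ Icc 0 T, FracMaxPrinciple.MemH10 Ω (fun x => max 0 (u t x)))
    -- the weak differential inequality
    (hsub : ∀ᵐ t ∂(volume.restrict (Ioo 0 T)), FracMaxPrinciple.WeakSubAt Ω α
      (fun x => a x t) (fun x => b x t) (fun x => c x t) u t) :
    ∀ t ∈ Icc 0 T, ∀ᵐ x ∂(volume.restrict Ω), u t x ≤ 0 := by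
  have : IsFiniteMeasure (volume.restrict Ω) := ⟨by simpa using hΩb.measure_lt_top⟩
  obtain ⟨C, hC⟩ := hC
  obtain ⟨P, hP⟩ := FracMaxPrinciple.exists_lipschitzWith_posPartL2 (μ := volume.restrict Ω)
  -- Clamping time freezes `w` at its value at `0` for negative times, which is zero by the initial
  -- condition.
  set w : ℝ → ℝ := fun s => ‖FracMaxPrinciple.posPartL2 (u (projIcc 0 T hT.le s))‖ with hwdef
  have hwu : ∀ s ∈ Icc 0 T, w s = ‖FracMaxPrinciple.posPartL2 (u s)‖ := fun s hs => by
    simp only [hwdef, projIcc_of_mem hT.le hs]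
  have hw : Continuous w := (hP.continuous.comp
    ((continuousOn_iff_continuous_domRestrict.1 hu).comp continuous_projIcc)).norm
  have hw0 : ∀ s, 0 ≤ w s := fun s => norm_nonneg _
  have hwz : ∀ s ≤ 0, w s = 0 := fun s hs => by
    simp only [hwdef, projIcc_of_le_left hT.le hs]
    rw [FracMaxPrinciple.posPartL2_eq_zero_iff.2 hu0, norm_zero]
  obtain ⟨B, hB⟩ := (isCompact_Icc (a := 0) (b := T)).exists_bound_of_continuousOn hw.continuousOn
  have hwB : ∀ s, w s ≤ B := fun s => by
    have h1 := hB _ (projIcc 0 T hT.le s).2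
    have h2 : w (projIcc 0 T hT.le s) = w s := by simp [hwdef]
    rw [h2] at h1
    exact (le_abs_self _).trans h1
  have hL : ∀ ε ∈ Ioo 0 T, ∃ L, LipschitzOnWith L w (Icc ε T) := by
    intro ε hε
    obtain ⟨L, hL⟩ := (hu' ε T hε.1 hε.2 le_rfl).exists_lipschitzOnWith hε.2
      (hu.mono (Icc_subset_Icc_left hε.1.le))
    refine ⟨P * L, LipschitzOnWith.of_dist_le_mul fun s hs t ht => ?_⟩
    rw [hwu s ⟨hε.1.le.trans hs.1, hs.2⟩, hwu t ⟨hε.1.le.trans ht.1, ht.2⟩]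
    refine (dist_norm_norm_le _ _).trans ?_
    rw [← dist_eq_norm]
    calc _ ≤ P * dist (u s) (u t) := hP.dist_le_mul _ _
      _ ≤ P * (L * dist s t) := by gcongr; exact hL.dist_le_mul s hs t ht
      _ = _ := by push_cast; ring
  have hK : ∀ᵐ t ∂volume.restrict (Ioo 0 T), w t * FracMaxPrinciple.marchaud α w t
      ≤ Real.Gamma (1 - α) * (C + lam) * w t ^ 2 := by
    have ha' : ∀ᵐ t ∂volume.restrict (Ioo 0 T), ∀ i j,
        MemLp (fun x => a x t i j) ∞ (volume.restrict Ω) :=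
      ae_all_iff.2 fun i => ae_all_iff.2 fun j => FracMaxPrinciple.ae_memLp_top_section (ha i j)
    have hb' : ∀ᵐ t ∂volume.restrict (Ioo 0 T), ∀ i,
        MemLp (fun x => b x t i) ∞ (volume.restrict Ω) :=
      ae_all_iff.2 fun i => FracMaxPrinciple.ae_memLp_top_section (hb i)
    filter_upwards [ha', hb', FracMaxPrinciple.ae_ae_section hpos,
      FracMaxPrinciple.ae_ae_section hC, FracMaxPrinciple.ae_ae_section hc, hsub,
      ae_restrict_mem measurableSet_Ioo] with t ha hb hpos hC hc hsub ht
    obtain ⟨D, hD, G, hG, hχ⟩ := hsub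
    have htI : t ∈ Icc 0 T := ⟨ht.1.le, ht.2.le⟩
    have hbdt := hbd t htI
    obtain ⟨H, hH, -⟩ := hbd t htI
    -- The test function is `χ = u(t)⁺`.
    obtain ⟨hint, hle⟩ := hχ _ H hbdt hH (Eventually.of_forall fun x => le_max_left _ _)
    have h1 := hD.mul_marchaud_le hα hu hwu hw hw0 hwB hwz hL ⟨ht.1, ht.2.le⟩
    have h2 := FracMaxPrinciple.neg_mul_integral_sq_le_form hd hΩo hΩb ha hb hpos hC hc hG hH hint
    rw [← FracMaxPrinciple.norm_posPartL2_sq, ← hwu t htI] at h2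
    refine h1.trans ?_
    rw [mul_assoc]
    exact mul_le_mul_of_nonneg_left (by linarith)
      (Real.Gamma_pos_of_pos (by linarith [hα.2])).le
  intro t ht
  have h := FracMaxPrinciple.eq_zero_of_mul_marchaud_le hα hw hw0 hwB hwz hL hK ht
  rw [hwu t ht, norm_eq_zero] at h
  exact FracMaxPrinciple.posPartL2_eq_zero_iff.1 h
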